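/- Let $\theta_n=e^{2\pi\sqrt{-1}/n}$ and define the following finite subgroups of $\mathrm{SU}_2$: $C_n=\langle \mathrm{diag}(\theta_n^{-1},\theta_n)\rangle$ (cyclic of order $n$), $D_n=\langle \mathrm{diag}(\theta_{2n}^{-1},\theta_{2n}),\,y\rangle$ (binary dihedral of order $4n$), $T=\langle \mathrm{diag}(\sqrt{-1},-\sqrt{-1}),\,y,\,z\rangle$ (binary tetrahedral), $O=\langle \mathrm{diag}(\theta_8,\theta_8^{-1}),\,y,\,z\rangle$ (binary octahedral), where $y=\begin{pmatrix}0&\sqrt{-1}\\ \sqrt{-1}&0\end{pmatrix}$ and $z=\frac1{\sqrt2}\begin{pmatrix}\theta_8^{-1}&\theta_8^{-1}\\-\theta_8&\theta_8\end{pmatrix}$. Let $V=\mathbb C^2$ be the natural module. For $N\unlhd G\le \mathrm{SU}_2$ write $\check\rho$ for the restriction to $N$ of a $G$-module $\rho$, and $\hat\phi$ for the $G$-module induced from an $N$-module $\phi$. Let $\{\check\rho_i\}_{i\in\check I}$ be a set of representatives, up to isomorphism, of the restrictions of the irreducible complex $G$-modules, no two of them having a common constituent, and let $\{\hat\phi_j\}_{j\in\hat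 I}$ be a set of representatives, up to isomorphism, of the $G$-modules induced from the irreducible complex $N$-modules. Put $$\check m^i(t)=\sum_{k\ge0}\dim\mathrm{Hom}_N(\check\rho_i,V^{\otimes k})\,t^k,\qquad \hat m^j(t)=\sum_{k\ge0}\dim\mathrm{Hom}_G(\hat\phi_j,V^{\otimes k})\,t^k .$$ The graph $\mathcal R_V(\hat N)$ has vertex set $\hat I$ and adjacency matrix $\widetilde B=(b_{ij})$ given by $V\otimes\hat\phi_j\cong\bigoplus_i b_{ij}\hat\phi_i$. A vertex $i$ is a long (short) root if the $i$-th simple root has maximal (has minimal, and not maximal) length among the simple roots with Cartan matrix $2I-\widetilde B=\left(2(\alpha_i,\alpha_j)/(\alpha_i,\alpha_i)\right)_{i,j}$. The special vertex of $\check I$ (of $\hat I$) is the one for which $\check\rho_i$ ($\phi_i$) is the trivial $N$-module. For each pair $(G,N)$ below there is a bijection $i\mapsto i'$ from $\check I$ to $\hat I$ such that $j=i'$ if and only if $\rho_i$ is isomorphic to a submodule of $\hat\phi_{j}$ and $\phi_{j}$ is isomorphic to a submodule of $\check\rho_i$. Moreover: (1) If $(G,N)$ is $(D_{2(n-1)},D_{n-1})$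 with $n\ge3$, $(D_n,C_{2n})$ with $n\ge2$, $(O,T)$ or $(T,D_2)$, then the matrix $\widetilde B$ exists, each $i'\in\hat I$ is a long or a short root of $\mathcal R_V(\hat N)$, and $$\check m^i(t)=\begin{cases}\hat m^{i'}(t), & i' \text{ a long root},\\ |G:N|\,\hat m^{i'}(t), & i'\text{ a short root}.\end{cases}$$ (2) If $(G,N)$ is $(D_2,C_2)$ or $(D_{2n},C_{2n})$ with $n\ge2$, then $\check m^0(t)=\hat m^0(t)$ for the special vertices, denoted by $0$, and if $i$ is not special, then $i'$ is not special and $$\check m^{i}(t)=2\,\hat m^{i'}(t).$$ -/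

import Mathlib

universe u v w w'

namespace McKaySlodowy

open scoped TensorProduct

/-! ### Finite subgroups of `SU₂` -/

/-- The group `SU₂` of unitary `2 × 2` complex matrices of determinant one. -/
abbrev SU2 : Type := Matrix.specialUnitaryGroup (Fin 2) ℂ

/-- `θ_n = exp (2πi / n)`. -/
noncomputable def theta (n : ℕ) : ℂ := Complex.exp (2 * Real.pi * Complex.I / n)

theorem star_theta (n : ℕ) : star (theta n) = (theta n)⁻¹ := by
  rw [theta, ← Complex.exp_neg, Complex.star_def, ← Complex.exp_conj]
  congr 1
  have h : (starRingEnd ℂ) (2 : ℂ) = 2 := map_ofNat _ 2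
  simp [neg_div, h]

theorem theta_ne_zero (n : ℕ) : theta n ≠ 0 := Complex.exp_ne_zero _

/-- `diag (θ_n⁻¹, θ_n)`. -/
noncomputable def rot (n : ℕ) : SU2 :=
  ⟨!![(theta n)⁻¹, 0; 0, theta n], by
    rw [Matrix.mem_specialUnitaryGroup_iff, Matrix.mem_unitaryGroup_iff]
    have h := theta_ne_zero n
    refine ⟨?_, by simp [Matrix.det_fin_two, h]⟩
    have hs := star_theta n
    rw [Complex.star_def] at hs
    ext i j
    fin_cases i <;> fin_cases j <;> simp [Matrix.mul_apply, Matrix.star_apply, h, hs]⟩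

/-- The matrix with rows `(0, √-1)` and `(√-1, 0)`. -/
noncomputable def matY : SU2 :=
  ⟨!![0, Complex.I; Complex.I, 0], by
    rw [Matrix.mem_specialUnitaryGroup_iff, Matrix.mem_unitaryGroup_iff]
    refine ⟨?_, by simp [Matrix.det_fin_two]⟩
    ext i j
    fin_cases i <;> fin_cases j <;> simp [Matrix.mul_apply, Matrix.star_apply]⟩

/-- `diag (√-1, -√-1)`. -/
noncomputable def matX : SU2 :=
  ⟨!![Complex.I, 0; 0, -Complex.I], by
    rw [Matrix.mem_specialUnitaryGroup_iff, Matrix.mem_unitaryGroup_iff]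
    refine ⟨?_, by simp [Matrix.det_fin_two]⟩
    ext i j
    fin_cases i <;> fin_cases j <;> simp [Matrix.mul_apply, Matrix.star_apply]⟩

theorem half_add_half :
    ((Real.sqrt 2 : ℝ) : ℂ)⁻¹ * ((Real.sqrt 2 : ℝ) : ℂ)⁻¹ +
      ((Real.sqrt 2 : ℝ) : ℂ)⁻¹ * ((Real.sqrt 2 : ℝ) : ℂ)⁻¹ = 1 := by
  have h : ((Real.sqrt 2 : ℝ) : ℂ) * ((Real.sqrt 2 : ℝ) : ℂ) = 2 := by
    rw [← Complex.ofReal_mul, Real.mul_self_sqrt (by norm_num)]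
    simp
  rw [← mul_inv, h]
  norm_num

/-- `2^{-1/2}` times the matrix with rows `(θ₈⁻¹, θ₈⁻¹)` and `(-θ₈, θ₈)`. -/
noncomputable def matZ : SU2 :=
  ⟨((Real.sqrt 2 : ℝ) : ℂ)⁻¹ • !![(theta 8)⁻¹, (theta 8)⁻¹; -theta 8, theta 8], by
    rw [Matrix.mem_specialUnitaryGroup_iff, Matrix.mem_unitaryGroup_iff]
    have h := theta_ne_zero 8
    have hs := star_theta 8
    rw [Complex.star_def] at hs
    have h2 := half_add_half
    generalize hr : ((Real.sqrt 2 : ℝ) : ℂ)⁻¹ = r at h2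
    have hrs : (starRingEnd ℂ) r = r := by
      rw [← hr, map_inv₀, Complex.conj_ofReal]
    refine ⟨?_, ?_⟩
    · ext i j
      fin_cases i <;> fin_cases j <;>
        simp [Matrix.mul_apply, Matrix.star_apply, hs, hrs] <;>
        field_simp <;> linear_combination h2
    · simp only [Matrix.smul_of, Matrix.smul_cons, Matrix.smul_empty, smul_eq_mul,
        Matrix.det_fin_two_of]
      field_simp
      linear_combination h2⟩

/-- The cyclic group `C_n`, of order `n`. -/
noncomputable def cyclic (n : ℕ) : Subgroup SU2 := Subgroup.closure {rot n}

/-- The binary dihedral group `D_n`, of order `4n`. -/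
noncomputable def binDihedral (n : ℕ) : Subgroup SU2 := Subgroup.closure {rot (2 * n), matY}

/-- The binary tetrahedral group `T`, of order `24`. -/
noncomputable def binTetrahedral : Subgroup SU2 := Subgroup.closure {matX, matY, matZ}

/-- The binary octahedral group `O`, of order `48`, generated by `diag (θ₈, θ₈⁻¹)` and the two
generators `y`, `z` of `T`. -/
noncomputable def binOctahedral : Subgroup SU2 := Subgroup.closure {(rot 8)⁻¹, matY, matZ}

/-- `(G, N)` is one of `(D_{2(n-1)}, D_{n-1})` with `n ≥ 3`, `(D_n, C_{2n})` with `n ≥ 2`,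
`(O, T)`, `(T, D_2)`. -/
def IsPrimeIndexPair (G N : Subgroup SU2) : Prop :=
  (∃ n : ℕ, 3 ≤ n ∧ G = binDihedral (2 * (n - 1)) ∧ N = binDihedral (n - 1)) ∨
  (∃ n : ℕ, 2 ≤ n ∧ G = binDihedral n ∧ N = cyclic (2 * n)) ∨
  (G = binOctahedral ∧ N = binTetrahedral) ∨
  (G = binTetrahedral ∧ N = binDihedral 2)

/-- `(G, N)` is `(D_2, C_2)` or `(D_{2n}, C_{2n})` with `n ≥ 2`. -/
def IsIndexFourPair (G N : Subgroup SU2) : Prop :=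
  (G = binDihedral 2 ∧ N = cyclic 2) ∨
  (∃ n : ℕ, 2 ≤ n ∧ G = binDihedral (2 * n) ∧ N = cyclic (2 * n))

/-- The natural module `ℂ²` of a subgroup of `SU₂`. -/
noncomputable def natRep (G : Subgroup SU2) : Representation ℂ G (Fin 2 → ℂ) :=
  ((Matrix.toLinAlgEquiv' : Matrix (Fin 2) (Fin 2) ℂ ≃ₐ[ℂ] _) :
      Matrix (Fin 2) (Fin 2) ℂ →* Module.End ℂ (Fin 2 → ℂ)).comp
    ((Matrix.specialUnitaryGroup (Fin 2) ℂ).subtype.comp G.subtype)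

/-! ### Restriction, induction, tensor powers -/

section General

variable {G : Type v} [Group G]

/-- The `G`-module `U^{⊗ k}` with the diagonal action. -/
noncomputable def tensorPower {U : Type w} [AddCommGroup U] [Module ℂ U]
    (V : Representation ℂ G U) (k : ℕ) : Representation ℂ G (⨂[ℂ]^k U) :=
  PiTensorProduct.mapMonoidHom.comp (MonoidHom.pi fun _ : Fin k => V)

/-- The restriction of a `G`-module to a subgroup `N`. -/
noncomputable abbrev res (N : Subgroup G) {U : Type w} [AddCommGroup U] [Module ℂ U]
    (ρ : Representation ℂ G U) : Representation ℂ N U :=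
  ρ.comp N.subtype

/-- The `G`-module induced from a module of a subgroup `N`. -/
noncomputable abbrev ind (N : Subgroup G) {U : Type w} [AddCommGroup U] [Module ℂ U]
    (φ : Representation ℂ N U) : Representation ℂ G (Representation.IndV N.subtype φ) :=
  Representation.ind N.subtype φ

/-- `σ` is isomorphic to a submodule of `τ`. -/
def Embeds {U : Type w} {U' : Type u} [AddCommGroup U] [Module ℂ U] [AddCommGroup U']
    [Module ℂ U'] (σ : Representation ℂ G U) (τ : Representation ℂ G U') : Prop :=
  ∃ f : σ.IntertwiningMap τ, Function.Injective f

/-- A module isomorphic to the trivial one-dimensional module. -/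
def IsTrivialModule {U : Type w} [AddCommGroup U] [Module ℂ U] (σ : Representation ℂ G U) : Prop :=
  Nonempty (σ.Equiv (Representation.trivial ℂ G ℂ))

/-- The restrictions to `N` of the irreducible `G`-modules `ρ i` represent, up to isomorphism, all
restrictions of irreducible `G`-modules, and no two of them have a common constituent. -/
structure IsRestrictedSystem (N : Subgroup G) {I : Type w} (ρ : I → Rep.{u} ℂ G) : Prop where
  finiteDimensional : ∀ i, FiniteDimensional ℂ (ρ i)
  irreducible : ∀ i, (ρ i).ρ.IsIrreducible
  disjoint : ∀ i j, i ≠ j →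
    ∀ f : (res N (ρ i).ρ).IntertwiningMap (res N (ρ j).ρ), f = 0
  complete : ∀ σ : Rep.{u} ℂ G, FiniteDimensional ℂ σ → σ.ρ.IsIrreducible →
    ∃ i, Nonempty ((res N σ.ρ).Equiv (res N (ρ i).ρ))

/-- The `G`-modules induced from the irreducible `N`-modules `φ i` are pairwise non-isomorphic and
represent, up to isomorphism, all `G`-modules induced from irreducible `N`-modules. -/
structure IsInducedSystem (N : Subgroup G) {I : Type w} (φ : I → Rep.{u} ℂ N) : Prop where
  finiteDimensional : ∀ i, FiniteDimensional ℂ (φ i)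
  irreducible : ∀ i, (φ i).ρ.IsIrreducible
  distinct : ∀ i j, i ≠ j → IsEmpty ((ind N (φ i).ρ).Equiv (ind N (φ j).ρ))
  complete : ∀ ψ : Rep.{u} ℂ N, FiniteDimensional ℂ ψ → ψ.ρ.IsIrreducible →
    ∃ i, Nonempty ((ind N ψ.ρ).Equiv (ind N (φ i).ρ))

/-- The restriction of `ρ` corresponds to the module induced from `φ`: `ρ` embeds in the induced
module, and `φ` embeds in the restriction of `ρ`. -/
def Corresponds (N : Subgroup G) (ρ : Rep.{u} ℂ G) (φ : Rep.{u} ℂ N) : Prop :=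
  Embeds ρ.ρ (ind N φ.ρ) ∧ Embeds φ.ρ (res N ρ.ρ)

/-! ### Poincaré series -/

/-- `∑ₖ dim Hom_N (Res ρ, V^{⊗ k}) tᵏ`. -/
noncomputable def resSeries (N : Subgroup G) {U : Type w} [AddCommGroup U] [Module ℂ U]
    (V : Representation ℂ G U) (ρ : Rep.{u} ℂ G) : PowerSeries ℕ :=
  PowerSeries.mk fun k =>
    Module.finrank ℂ ((res N ρ.ρ).IntertwiningMap (res N (tensorPower V k)))

/-- `∑ₖ dim Hom_G (Ind φ, V^{⊗ k}) tᵏ`. -/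
noncomputable def indSeries (N : Subgroup G) {U : Type w} [AddCommGroup U] [Module ℂ U]
    (V : Representation ℂ G U) (φ : Rep.{u} ℂ N) : PowerSeries ℕ :=
  PowerSeries.mk fun k =>
    Module.finrank ℂ ((ind N φ.ρ).IntertwiningMap (tensorPower V k))

/-! ### The representation graph of the induced modules, and long and short roots -/

/-- `B` is the adjacency matrix of the representation graph of the induced modules `Ind (φ i)` with
respect to `V`, that is, `V ⊗ Ind (φ j) ≅ ⨁ i, B i j • Ind (φ i)` for all `j`. -/
def IsAdjacencyMatrix (N : Subgroup G) {U : Type w} [AddCommGroup U] [Module ℂ U]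
    (V : Representation ℂ G U) {I : Type w'} (φ : I → Rep.{u} ℂ N) (B : Matrix I I ℕ) : Prop :=
  ∀ j, Nonempty ((V.tprod (ind N (φ j).ρ)).Equiv
    (Representation.directSum fun p : (Σ i, Fin (B i j)) => ind N (φ p.1).ρ))

end General

/-- `d` gives half the squared lengths `d i = (αᵢ, αᵢ) / 2` of the simple roots of the generalized
Cartan matrix `A i j = 2 (αᵢ, αⱼ) / (αᵢ, αᵢ)`: the numbers `d i` are positive and
`(d i * A i j)` is a symmetric matrix. -/
def IsRootLength {I : Type*} (A : Matrix I I ℤ) (d : I → ℝ) : Prop :=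
  (∀ i, 0 < d i) ∧ ∀ i j, d i * A i j = d j * A j i

/-- The simple root `i` has the maximal length among all simple roots. -/
def IsLongRoot {I : Type*} (A : Matrix I I ℤ) (i : I) : Prop :=
  ∃ d : I → ℝ, IsRootLength A d ∧ ∀ j, d j ≤ d i

/-- The simple root `i` has the minimal length among all simple roots, and not all simple roots
have this length. -/
def IsShortRoot {I : Type*} (A : Matrix I I ℤ) (i : I) : Prop :=
  ∃ d : I → ℝ, IsRootLength A d ∧ (∀ j, d i ≤ d j) ∧ ∃ j, d i < d j

/-- The Cartan matrix `2 I - B` of a graph with adjacency matrix `B`. -/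
def cartan {I : Type*} [DecidableEq I] (B : Matrix I I ℕ) : Matrix I I ℤ :=
  2 - B.map (fun b : ℕ => (b : ℤ))

end McKaySlodowy

open McKaySlodowy

/-! The theorem is Clifford theory plus a dimension count. Let the irreducible `N`-module `ψ` occur
in `Res ρᵢ`. By Frobenius reciprocity every constituent of `Ind ψ` restricts to a module containing
`ψ`; since distinct restricted modules have no common constituent, it restricts like `ρᵢ`. So `Res
Ind ψ` has character `k` times that of `Res ρᵢ`, and pairing with `Res τ` gives `k · dim Hom_N(Res
ρᵢ, Res τ) = |G:N| · dim Hom_N(ψ, Res τ)`. The regular module determines `k`, whence `dim ψ · dim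
Hom_N(Res ρᵢ, Res τ) = dim ρᵢ · dim Hom_N(ψ, Res τ)` (`IsRestrictedSystem.finrank_mul_homDim`). With
`τ = V^{⊗ k}`, the two series differ by the factor `rᵢ = dim ρᵢ / dim φ_{i'}`. The same identity,
together with the equality of dimensions of the constituents of `Res ρᵢ`, yields the bijection
(`IsRestrictedSystem.exists_bijection`).

For prime index `p`, twisting by the characters of `G/N` shows that `Res ρᵢ` is multiplicity free
and `rᵢ ∈ {1, p}`. The entries of `B` are therefore `dim Hom_N(φ_j, V ⊗ ρ_k)`, and self-duality of
`V` makes `1 / r` a vector of root lengths. As `V` is faithful, every `Res ρ_l` meets some tensor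
power of `V` (Burnside), so the graph is connected and root lengths are unique up to scale
(`rootLength_mul_eq`). The trivial module has `r = 1`; hence long means `r = 1` and short means `r =
p` (`long_short_of_prime_index`).

For the pairs of index four, `N` is abelian, so `dim φ_j = 1`, and irreducible `G`-modules have
dimension at most two. Those of dimension one are trivial on `N`, so `r = 2` off the special vertex.
-/

namespace McKaySlodowy

open Representation Module
open scoped TensorProduct DirectSum

/-! ### Change of the underlying space of a representation -/

section Transport

variable {G : Type*} [Monoid G] {U W : Type*} [AddCommGroup U] [Module ℂ U]
  [AddCommGroup W] [Module ℂ W]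

/-- The representation on `W` obtained from one on `U` along a linear equivalence. -/
def transport (σ : Representation ℂ G U) (e : U ≃ₗ[ℂ] W) : Representation ℂ G W where
  toFun g := e.conj (σ g)
  map_one' := by simp [Module.End.one_eq_id]
  map_mul' g h := by simp [Module.End.mul_eq_comp, LinearEquiv.conj_comp]

/-- Transporting a representation gives an equivalent one. -/
def transportEquiv (σ : Representation ℂ G U) (e : U ≃ₗ[ℂ] W) : σ.Equiv (transport σ e) :=
  .mk e fun g => by ext; simp [transport, LinearEquiv.conj_apply_apply]

theorem isIrreducible_of_equiv {σ : Representation ℂ G U} {τ : Representation ℂ G W}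
    (e : σ.Equiv τ) (h : σ.IsIrreducible) : τ.IsIrreducible := by
  rw [irreducible_iff_isSimpleModule_asModule] at h ⊢
  let e1 := IntertwiningMap.equivLinearMapAsModule σ τ e.toIntertwiningMap
  have hb : Function.Bijective e1 := e.toLinearEquiv.bijective
  exact IsSimpleModule.congr (LinearEquiv.ofBijective e1 hb).symm

end Transport

/-! ### Irreducible submodules and Maschke complements -/

section Decomposition

variable {G : Type*} [Group G]

theorem nontrivial_of_isIrreducible {U : Type*} [AddCommGroup U] [Module ℂ U]
    {σ : Representation ℂ G U} (h : σ.IsIrreducible) : Nontrivial U := by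
  by_contra hU
  rw [not_nontrivial_iff_subsingleton] at hU
  obtain ⟨a, b, hab⟩ := h.toNontrivial
  exact hab (Subrepresentation.ext (Subsingleton.elim _ _))

theorem isIrreducible_of_forall {U : Type*} [AddCommGroup U] [Module ℂ U] [Nontrivial U]
    {σ : Representation ℂ G U}
    (h : ∀ S : Subrepresentation σ, S.toSubmodule ≠ ⊥ → S.toSubmodule = ⊤) :
    σ.IsIrreducible := by
  have : Nontrivial (Subrepresentation σ) := by
    refine ⟨⊥, ⊤, fun h => ?_⟩
    exact bot_ne_top (α := Submodule ℂ U) (congrArg Subrepresentation.toSubmodule h)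
  refine ⟨fun S => ?_⟩
  by_cases hS : S.toSubmodule = ⊥
  · exact .inl (Subrepresentation.ext hS)
  · exact .inr (Subrepresentation.ext (h S hS))

/-- The inclusion of a subrepresentation. -/
def inclusion {U : Type*} [AddCommGroup U] [Module ℂ U] {σ : Representation ℂ G U}
    (S : Subrepresentation σ) : S.toRepresentation.IntertwiningMap σ :=
  ⟨S.toSubmodule.subtype, fun _ => rfl⟩

/-- The irreducible is realised on `Fin n → ℂ`, so that later statements can quantify over all
irreducibles inside one universe. -/
theorem exists_irreducible_embedding {U : Type*} [AddCommGroup U] [Module ℂ U]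
    [FiniteDimensional ℂ U] [Nontrivial U] (σ : Representation ℂ G U) :
    ∃ (n : ℕ) (π : Representation ℂ G (Fin n → ℂ)), π.IsIrreducible ∧ Embeds π σ := by
  induction hd : finrank ℂ U using Nat.strong_induction_on generalizing U with
  | _ d ih =>
  by_cases h : σ.IsIrreducible
  · let e := (finBasis ℂ U).equivFun
    exact ⟨_, transport σ e, isIrreducible_of_equiv (transportEquiv σ e) h,
      (transportEquiv σ e).symm.toIntertwiningMap, (transportEquiv σ e).symm.toLinearEquiv.injective⟩
  · obtain ⟨S, hS, hS'⟩ : ∃ S : Subrepresentation σ, S.toSubmodule ≠ ⊥ ∧ S.toSubmodule ≠ ⊤ := by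
      by_contra! hc
      exact h (isIrreducible_of_forall hc)
    have : Nontrivial S.toSubmodule := Submodule.nontrivial_iff_ne_bot.2 hS
    obtain ⟨n, π, hπ, f, hf⟩ := ih _ (hd ▸ Submodule.finrank_lt hS') S.toRepresentation rfl
    exact ⟨n, π, hπ, (inclusion S).comp f, (Submodule.subtype_injective _).comp hf⟩

theorem exists_complement [Finite G] {U W : Type*} [AddCommGroup U] [Module ℂ U]
    [AddCommGroup W] [Module ℂ W] [FiniteDimensional ℂ W]
    {σ : Representation ℂ G U} {τ : Representation ℂ G W} (h : Embeds σ τ) :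
    ∃ (m : ℕ) (τ' : Representation ℂ G (Fin m → ℂ)), Nonempty (τ.Equiv (σ.prod τ')) := by
  obtain ⟨f, hf⟩ := h
  have : NeZero (Nat.card G : ℂ) := ⟨Nat.cast_ne_zero.2 Nat.card_pos.ne'⟩
  obtain ⟨r', hr'⟩ := MonoidAlgebra.exists_leftInverse_of_injective
    (IntertwiningMap.equivLinearMapAsModule σ τ f) (LinearMap.ker_eq_bot.2 hf)
  let r : τ.IntertwiningMap σ := (IntertwiningMap.equivLinearMapAsModule τ σ).symm r'
  have hr : ∀ x, r (f x) = x := fun x => LinearMap.congr_fun hr' x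
  let e := (finBasis ℂ r.ker.toSubmodule).equivFun
  refine ⟨_, transport r.ker.toRepresentation e, ⟨?_⟩⟩
  -- Since `r ∘ f = id`, the map `id - f ∘ r` is the projection onto the complement `ker r` of the
  -- image of `f`.
  let q : W →ₗ[ℂ] r.ker.toSubmodule :=
    LinearMap.codRestrict _ (LinearMap.id - f.toLinearMap ∘ₗ r.toLinearMap) fun y => by
      change r (y - f (r y)) = 0
      rw [map_sub, hr, sub_self]
  have hq : ∀ y, (q y : W) = y - f (r y) := fun _ => rfl
  let qi : τ.IntertwiningMap r.ker.toRepresentation := ⟨q, fun g => by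
    ext y
    change (τ g y - f (r (τ g y)) : W) = τ g (y - f (r y))
    rw [map_sub, r.isIntertwining, f.isIntertwining]⟩
  refine IntertwiningMap.ofBijective
    (r.prod ((transportEquiv r.ker.toRepresentation e).toIntertwiningMap.comp qi)) ⟨?_, ?_⟩
  · refine (injective_iff_map_eq_zero _).2 fun y hy => ?_
    have h1 : r y = 0 := congrArg Prod.fst hy
    have h2 : e (q y) = 0 := congrArg Prod.snd hy
    have h3 : (q y : W) = 0 := by rw [(LinearEquiv.map_eq_zero_iff e).1 h2]; rfl
    rwa [hq, h1, map_zero, sub_zero] at h3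
  · rintro ⟨a, b⟩
    have hk : r (e.symm b : W) = 0 := (e.symm b).2
    refine ⟨f a + (e.symm b : W), Prod.ext ?_ ?_⟩
    · change r (f a + (e.symm b : W)) = a
      rw [map_add, hr, hk, add_zero]
    · change e (q (f a + (e.symm b : W))) = b
      rw [← LinearEquiv.eq_symm_apply]
      apply Subtype.ext
      rw [hq, map_add, hr, hk, add_zero, add_sub_cancel_left]

end Decomposition

/-! ### Multiplicities computed from characters -/

section HomDim

variable {G : Type*} [Group G]

/-- The dimension of the space of intertwining maps. -/
noncomputable abbrev homDim {U W : Type*} [AddCommGroup U] [Module ℂ U] [AddCommGroup W]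
    [Module ℂ W] (σ : Representation ℂ G U) (τ : Representation ℂ G W) : ℕ :=
  finrank ℂ (σ.IntertwiningMap τ)

section

variable {U W : Type*} [AddCommGroup U] [Module ℂ U] [AddCommGroup W]
  [Module ℂ W] {σ : Representation ℂ G U} {τ : Representation ℂ G W}
  {U' W' : Type*} [AddCommGroup U'] [Module ℂ U'] [AddCommGroup W']
  [Module ℂ W'] {σ' : Representation ℂ G U'} {τ' : Representation ℂ G W'}

theorem homDim_ne_zero_iff [FiniteDimensional ℂ U] [FiniteDimensional ℂ W] :
    homDim σ τ ≠ 0 ↔ ∃ f : σ.IntertwiningMap τ, f ≠ 0 := by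
  rw [← Nat.pos_iff_ne_zero, finrank_pos_iff_exists_ne_zero]

theorem homDim_ne_zero_iff_embeds [FiniteDimensional ℂ U] [FiniteDimensional ℂ W]
    (hσ : σ.IsIrreducible) : homDim σ τ ≠ 0 ↔ Embeds σ τ := by
  rw [homDim_ne_zero_iff]
  constructor
  · rintro ⟨f, hf⟩
    exact ⟨f, (IsIrreducible.injective_or_eq_zero f).resolve_right hf⟩
  · rintro ⟨f, hf⟩
    refine ⟨f, ?_⟩
    rintro rfl
    have := nontrivial_of_isIrreducible hσ
    obtain ⟨x, hx⟩ := exists_ne (0 : U)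
    exact hx (hf (by rfl))

theorem finrank_pos_of_isIrreducible [FiniteDimensional ℂ U] (hσ : σ.IsIrreducible) :
    0 < finrank ℂ U := by
  have := nontrivial_of_isIrreducible hσ
  exact finrank_pos

theorem card_mul_homDim [Fintype G] [FiniteDimensional ℂ U] [FiniteDimensional ℂ W]
    (σ : Representation ℂ G U) (τ : Representation ℂ G W) :
    (Nat.card G : ℂ) * homDim σ τ = ∑ g, σ.character g⁻¹ * τ.character g := by
  have h0 : (Nat.card G : ℂ) ≠ 0 := Nat.cast_ne_zero.2 Nat.card_pos.ne'
  let _ := invertibleOfNonzero h0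
  rw [← card_inv_mul_sum_char_mul_char_eq_finrank, mul_inv_cancel_left₀ h0]
  exact Finset.sum_congr rfl fun _ _ => mul_comm _ _

variable [Finite G] [FiniteDimensional ℂ U] [FiniteDimensional ℂ W]
  [FiniteDimensional ℂ U'] [FiniteDimensional ℂ W']

/-- Turns an identity of character sums, possibly over two different groups, into one between
multiplicities; the group orders are cleared of denominators. -/
theorem homDim_congr_sum {H : Type*} [Group H] [Fintype G] [Fintype H]
    {σ' : Representation ℂ H U'} {τ' : Representation ℂ H W'} {a b : ℕ}
    (h : (b : ℂ) * (Nat.card H : ℂ) * ∑ g, σ.character g⁻¹ * τ.character g =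
      (a : ℂ) * (Nat.card G : ℂ) * ∑ g, σ'.character g⁻¹ * τ'.character g) :
    b * homDim σ τ = a * homDim σ' τ' := by
  have h0 : (Nat.card G : ℂ) ≠ 0 := Nat.cast_ne_zero.2 Nat.card_pos.ne'
  have h1 : (Nat.card H : ℂ) ≠ 0 := Nat.cast_ne_zero.2 Nat.card_pos.ne'
  rw [← card_mul_homDim, ← card_mul_homDim] at h
  have h2 : (b * homDim σ τ : ℂ) = a * homDim σ' τ' := by
    apply mul_left_cancel₀ (mul_ne_zero h0 h1)
    linear_combination h
  exact_mod_cast h2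

theorem homDim_comm : homDim σ τ = homDim τ σ := by
  have := Fintype.ofFinite G
  have := homDim_congr_sum (σ := σ) (τ := τ) (σ' := τ) (τ' := σ) (a := 1) (b := 1) (by
    congr 1
    refine Fintype.sum_equiv (_root_.Equiv.inv G) _ _ fun g => ?_
    simp [mul_comm])
  simpa using this

theorem homDim_congr (h : ∀ g, σ.character g⁻¹ * τ.character g = σ'.character g⁻¹ * τ'.character g) :
    homDim σ τ = homDim σ' τ' := by
  have := Fintype.ofFinite G
  have := homDim_congr_sum (σ := σ) (τ := τ) (σ' := σ') (τ' := τ') (a := 1) (b := 1) (by simp [h])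
  simpa using this

theorem homDim_congr_left (e : σ.character = σ'.character) : homDim σ τ = homDim σ' τ :=
  homDim_congr fun g => by rw [e]

theorem homDim_congr_right (e : τ.character = τ'.character) : homDim σ τ = homDim σ τ' :=
  homDim_congr fun g => by rw [e]

omit [Finite G] in
theorem character_prod (g : G) :
    (σ.prod τ).character g = σ.character g + τ.character g :=
  LinearMap.trace_prodMap' (σ g) (τ g)

theorem homDim_prod {X : Type*} [AddCommGroup X] [Module ℂ X] [FiniteDimensional ℂ X]
    (π : Representation ℂ G X) : homDim π (σ.prod τ) = homDim π σ + homDim π τ := by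
  have := Fintype.ofFinite G
  have h0 : (Nat.card G : ℂ) ≠ 0 := Nat.cast_ne_zero.2 Nat.card_pos.ne'
  have : (homDim π (σ.prod τ) : ℂ) = homDim π σ + homDim π τ := by
    apply mul_left_cancel₀ h0
    rw [mul_add]
    simp only [card_mul_homDim, character_prod, mul_add, Finset.sum_add_distrib]
  exact_mod_cast this

theorem homDim_sum {X : Type*} [AddCommGroup X] [Module ℂ X] [FiniteDimensional ℂ X]
    {ι : Type*} [Fintype ι] {n : ι → ℕ} (ψ : ∀ i, Representation ℂ G (Fin (n i) → ℂ))
    (π : Representation ℂ G X) (h : ∀ g, σ.character g = ∑ i, (ψ i).character g) :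
    homDim σ π = ∑ i, homDim (ψ i) π := by
  have := Fintype.ofFinite G
  have h0 : (Nat.card G : ℂ) ≠ 0 := Nat.cast_ne_zero.2 Nat.card_pos.ne'
  have : (homDim σ π : ℂ) = ∑ i, (homDim (ψ i) π : ℂ) := by
    apply mul_left_cancel₀ h0
    rw [Finset.mul_sum]
    simp only [card_mul_homDim, h, Finset.sum_mul]
    exact Finset.sum_comm
  exact_mod_cast this

omit [Finite G] [FiniteDimensional ℂ U] [FiniteDimensional ℂ W] in
theorem finrank_eq_of_equiv (e : σ.Equiv τ) : finrank ℂ U = finrank ℂ W :=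
  e.toLinearEquiv.finrank_eq

omit [Finite G] in
theorem equiv_of_homDim_ne_zero (hσ : σ.IsIrreducible) (hτ : τ.IsIrreducible)
    (h : homDim σ τ ≠ 0) : Nonempty (σ.Equiv τ) := by
  obtain ⟨f, hf⟩ := homDim_ne_zero_iff.1 h
  exact ⟨f.ofBijective ((IsIrreducible.bijective_or_eq_zero f).resolve_right hf)⟩

theorem homDim_le_one (hσ : σ.IsIrreducible) (hτ : τ.IsIrreducible) : homDim σ τ ≤ 1 := by
  by_cases h : homDim σ τ = 0
  · omega
  · obtain ⟨e⟩ := equiv_of_homDim_ne_zero hσ hτ h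
    rw [← homDim_congr_right (char_iso e), homDim, IsIrreducible.finrank_intertwiningMap_self]

end

theorem Embeds.congr_right {U W X : Type*} [AddCommGroup U] [Module ℂ U] [AddCommGroup W]
    [Module ℂ W] [AddCommGroup X] [Module ℂ X] {σ : Representation ℂ G U}
    {τ : Representation ℂ G W} {π : Representation ℂ G X} (h : Embeds π σ) (e : σ.Equiv τ) :
    Embeds π τ := by
  obtain ⟨f, hf⟩ := h
  exact ⟨e.toIntertwiningMap.comp f, e.toLinearEquiv.injective.comp hf⟩

theorem character_eq_sum_irreducible_fin [Finite G] (d : ℕ)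
    (σ : Representation ℂ G (Fin d → ℂ)) :
    ∃ (k : ℕ) (n : Fin k → ℕ) (π : ∀ a, Representation ℂ G (Fin (n a) → ℂ)),
      (∀ a, (π a).IsIrreducible ∧ Embeds (π a) σ) ∧
      ∀ g, σ.character g = ∑ a, (π a).character g := by
  induction d using Nat.strong_induction_on with
  | _ d ih =>
  rcases subsingleton_or_nontrivial (Fin d → ℂ) with hU | hU
  · refine ⟨0, Fin.elim0, fun a => a.elim0, fun a => a.elim0, fun g => ?_⟩
    rw [character, Subsingleton.elim (σ g) 0]
    simp
  · obtain ⟨n, π, hπ, hemb⟩ := exists_irreducible_embedding σ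
    obtain ⟨m, σ', ⟨e⟩⟩ := exists_complement hemb
    have hfr := finrank_eq_of_equiv e
    have hp := finrank_pos_of_isIrreducible hπ
    rw [finrank_prod] at hfr
    simp only [finrank_fintype_fun_eq_card, Fintype.card_fin] at hfr hp
    obtain ⟨k, n', π', h1, h2⟩ := ih m (by omega) σ'
    refine ⟨k + 1, Fin.cons n n', Fin.cons π π', ?_, fun g => ?_⟩
    · intro a
      refine Fin.cases ⟨hπ, hemb⟩ (fun b => ⟨(h1 b).1, ?_⟩) a
      obtain ⟨f, hf⟩ := (h1 b).2
      refine Embeds.congr_right (σ := π.prod σ')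
        ⟨(IntertwiningMap.inr ℂ π σ').comp f, fun x y h => hf (congrArg Prod.snd h)⟩ e.symm
    · rw [char_iso e, character_prod, h2, Fin.sum_univ_succ]
      rfl

theorem character_eq_sum_irreducible [Finite G] {U : Type*} [AddCommGroup U] [Module ℂ U]
    [FiniteDimensional ℂ U] (σ : Representation ℂ G U) :
    ∃ (k : ℕ) (n : Fin k → ℕ) (π : ∀ a, Representation ℂ G (Fin (n a) → ℂ)),
      (∀ a, (π a).IsIrreducible ∧ Embeds (π a) σ) ∧
      ∀ g, σ.character g = ∑ a, (π a).character g := by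
  let e := transportEquiv σ (finBasis ℂ U).equivFun
  obtain ⟨k, n, π, h1, h2⟩ := character_eq_sum_irreducible_fin _ (transport σ (finBasis ℂ U).equivFun)
  exact ⟨k, n, π, fun a => ⟨(h1 a).1, (h1 a).2.congr_right e.symm⟩, fun g => by
    rw [← h2, char_iso e]⟩

/-- An irreducible submodule of `σ` also embeds in `τ`; both copies are split off, and the
multiplicities of the complements still agree because they are additive. -/
theorem equiv_of_homDim_eq_fin [Finite G] (d d' : ℕ)
    (σ : Representation ℂ G (Fin d → ℂ)) (τ : Representation ℂ G (Fin d' → ℂ))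
    (h : ∀ (n : ℕ) (π : Representation ℂ G (Fin n → ℂ)), π.IsIrreducible →
      homDim π σ = homDim π τ) : Nonempty (σ.Equiv τ) := by
  induction d using Nat.strong_induction_on generalizing d' with
  | _ d ih =>
  rcases subsingleton_or_nontrivial (Fin d → ℂ) with hU | hU
  · have hW : Subsingleton (Fin d' → ℂ) := by
      by_contra hW
      rw [not_subsingleton_iff_nontrivial] at hW
      obtain ⟨n, π, hπ, hemb⟩ := exists_irreducible_embedding τ
      have := (homDim_ne_zero_iff_embeds hπ).2 hemb
      rw [← h n π hπ, homDim_ne_zero_iff] at this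
      obtain ⟨f, hf⟩ := this
      exact hf (IntertwiningMap.ext (LinearMap.ext fun x => Subsingleton.elim _ _))
    exact ⟨.mk 0 fun g => LinearMap.ext fun x => Subsingleton.elim _ _⟩
  · obtain ⟨n, π, hπ, hemb⟩ := exists_irreducible_embedding σ
    have hemb' : Embeds π τ := by
      rw [← homDim_ne_zero_iff_embeds hπ, ← h n π hπ, homDim_ne_zero_iff_embeds hπ]
      exact hemb
    obtain ⟨m, σ', ⟨e⟩⟩ := exists_complement hemb
    obtain ⟨m', τ', ⟨e'⟩⟩ := exists_complement hemb'
    have hfr := finrank_eq_of_equiv e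
    have hp := finrank_pos_of_isIrreducible hπ
    rw [finrank_prod] at hfr
    simp only [finrank_fintype_fun_eq_card, Fintype.card_fin] at hfr hp
    obtain ⟨e''⟩ := ih m (by omega) m' σ' τ' (fun n π' hπ' => by
      have := h n π' hπ'
      rw [homDim_congr_right (char_iso e), homDim_congr_right (char_iso e'), homDim_prod,
        homDim_prod] at this
      omega)
    refine ⟨(e.trans (.mk ((LinearEquiv.refl ℂ _).prodCongr e''.toLinearEquiv) ?_)).trans e'.symm⟩
    intro g
    refine LinearMap.ext fun x => Prod.ext rfl ?_
    exact e''.toIntertwiningMap.isIntertwining _ _ g x.2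

/-- Finite-dimensional representations with the same multiplicities are equivalent. -/
theorem equiv_of_homDim_eq [Finite G] {U W : Type*} [AddCommGroup U] [Module ℂ U]
    [FiniteDimensional ℂ U] [AddCommGroup W] [Module ℂ W] [FiniteDimensional ℂ W]
    (σ : Representation ℂ G U) (τ : Representation ℂ G W)
    (h : ∀ (n : ℕ) (π : Representation ℂ G (Fin n → ℂ)), π.IsIrreducible →
      homDim π σ = homDim π τ) : Nonempty (σ.Equiv τ) := by
  let e := transportEquiv σ (finBasis ℂ U).equivFun
  let e' := transportEquiv τ (finBasis ℂ W).equivFun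
  obtain ⟨e''⟩ := equiv_of_homDim_eq_fin _ _ (transport σ (finBasis ℂ U).equivFun)
    (transport τ (finBasis ℂ W).equivFun) fun n π hπ => by
      rw [← homDim_congr_right (char_iso e), ← homDim_congr_right (char_iso e'), h n π hπ]
  exact ⟨(e.trans e'').trans e'.symm⟩

end HomDim

/-! ### Frobenius reciprocity -/

section Induction

variable {G : Type*} [Group G] (N : Subgroup G) {U W : Type*} [AddCommGroup U] [Module ℂ U]
  [AddCommGroup W] [Module ℂ W]

instance [Finite G] (φ : Representation ℂ N U) [FiniteDimensional ℂ U] :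
    FiniteDimensional ℂ (Representation.IndV N.subtype φ) :=
  haveI : FiniteDimensional ℂ (MonoidAlgebra ℂ G) :=
    Module.Finite.equiv (MonoidAlgebra.coeffLinearEquiv ℂ).symm
  inferInstance

/-- Frobenius reciprocity. -/
noncomputable def indHomEquiv (φ : Representation ℂ N U) (τ : Representation ℂ G W) :
    (ind N φ).IntertwiningMap τ ≃ₗ[ℂ] φ.IntertwiningMap (res N τ) where
  toFun f := ⟨f.toLinearMap ∘ₗ IndV.mk N.subtype φ 1, fun g ↦ by
    ext x
    have := (f.isIntertwining _ _ (N.subtype g) (IndV.mk N.subtype φ 1 x)).symm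
    simp_all [← Coinvariants.mk_inv_tmul]⟩
  map_add' _ _ := rfl
  map_smul' _ _ := rfl
  invFun f := ⟨Representation.Coinvariants.lift _
    (TensorProduct.lift <| (Finsupp.lift _ _ _ fun h => τ h⁻¹ ∘ₗ f.toLinearMap) ∘ₗ
      (MonoidAlgebra.coeffLinearEquiv ℂ).toLinearMap)
    fun g ↦ by
      have := f.isIntertwining _ _ g
      ext h x
      simp only [LinearMap.coe_comp, Function.comp_apply, MonoidAlgebra.lsingle_apply]
      simp [ofMulAction_single, mul_inv_rev, this], fun g ↦ by ext; simp⟩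
  left_inv f := by
    ext h a
    simpa using (f.isIntertwining _ _ h⁻¹ (IndV.mk N.subtype φ 1 a)).symm
  right_inv _ := by ext; simp

theorem homDim_ind (φ : Representation ℂ N U) (τ : Representation ℂ G W) :
    homDim (ind N φ) τ = homDim φ (res N τ) :=
  (indHomEquiv N φ τ).finrank_eq

end Induction

section DirectSum

variable {G : Type*} [Group G] {ι : Type*} [Fintype ι] {U : ι → Type*}
  [∀ i, AddCommGroup (U i)] [∀ i, Module ℂ (U i)]

/-- Intertwining maps into a finite direct sum. -/
noncomputable def directSumHomEquiv {X : Type*} [AddCommGroup X] [Module ℂ X]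
    (π : Representation ℂ G X) (σ : ∀ i, Representation ℂ G (U i)) :
    π.IntertwiningMap (directSum σ) ≃ₗ[ℂ] ∀ i, π.IntertwiningMap (σ i) where
  toFun f i := ⟨DirectSum.component ℂ ι U i ∘ₗ f.toLinearMap, fun g => by
    ext x
    have := f.isIntertwining _ _ g x
    simp_all [directSum, DirectSum.component]
    rfl⟩
  map_add' _ _ := rfl
  map_smul' _ _ := rfl
  invFun f := ⟨(DirectSum.linearEquivFunOnFintype ℂ ι U).symm ∘ₗ
      LinearMap.pi fun i => (f i).toLinearMap, fun g => by
    ext x i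
    exact (f i).isIntertwining _ _ g x⟩
  left_inv f := by ext x i; rfl
  right_inv f := by ext i x; rfl

theorem homDim_directSum {X : Type*} [AddCommGroup X] [Module ℂ X] [FiniteDimensional ℂ X]
    [∀ i, FiniteDimensional ℂ (U i)]
    (π : Representation ℂ G X) (σ : ∀ i, Representation ℂ G (U i)) :
    homDim π (directSum σ) = ∑ i, homDim π (σ i) := by
  rw [homDim, (directSumHomEquiv π σ).finrank_eq, finrank_pi_fintype]

end DirectSum

/-! ### The regular module and the functions on `G ⧸ N` -/

section Permutation

variable (G S : Type*) [Group G] [MulAction G S]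

/-- The permutation representation on the functions on a `G`-set. -/
def permRep : Representation ℂ G (S → ℂ) where
  toFun g := LinearMap.funLeft ℂ ℂ fun x : S => g⁻¹ • x
  map_one' := by ext; simp [LinearMap.funLeft]
  map_mul' g h := by ext; simp [LinearMap.funLeft, mul_smul]

open Classical in
theorem character_permRep [Fintype S] (g : G) :
    (permRep G S).character g = ∑ x : S, if g⁻¹ • x = x then 1 else 0 := by
  rw [character, LinearMap.trace_eq_matrix_trace ℂ (Pi.basisFun ℂ S), Matrix.trace]
  refine Finset.sum_congr rfl fun x _ => ?_
  simp [permRep, LinearMap.funLeft, Pi.single_apply]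

open Classical in
theorem character_permRep_self [Fintype G] (g : G) :
    (permRep G G).character g = if g = 1 then (Nat.card G : ℂ) else 0 := by
  rw [character_permRep]
  split_ifs with h <;> simp [h]

-- As `N` is normal, an element fixing one coset of `N` fixes all of them.
open Classical in
theorem character_permRep_quotient [Finite G] (N : Subgroup G) [N.Normal] (g : G) :
    (permRep G (G ⧸ N)).character g = if g ∈ N then (N.index : ℂ) else 0 := by
  have := Fintype.ofFinite (G ⧸ N)
  have key : ∀ x : G ⧸ N, g⁻¹ • x = x ↔ g ∈ N := fun x => by
    induction x using QuotientGroup.induction_on with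
    | _ a =>
    change ((g⁻¹ * a : G) : G ⧸ N) = a ↔ _
    rw [QuotientGroup.mk_mul, mul_eq_right, QuotientGroup.eq_one_iff, inv_mem_iff]
  rw [character_permRep]
  simp only [key]
  split_ifs with h <;> simp [Subgroup.index]

end Permutation

/-! ### Restriction to a normal subgroup -/

section Restriction

variable {G : Type v} [Group G] {N : Subgroup G}

theorem character_res {U : Type*} [AddCommGroup U] [Module ℂ U] (σ : Representation ℂ G U)
    (n : N) : (res N σ).character n = σ.character n := rfl

/-- The restriction of an equivalence to a subgroup. -/
noncomputable def resEquiv {U W : Type*} [AddCommGroup U] [Module ℂ U] [AddCommGroup W] [Module ℂ W]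
    {σ : Representation ℂ G U} {τ : Representation ℂ G W} (e : σ.Equiv τ) :
    (res N σ).Equiv (res N τ) :=
  .mk e.toLinearEquiv fun g => e.isIntertwining' g

open Classical in
theorem sum_subgroup [Fintype G] [Fintype N] (f : G → ℂ) :
    ∑ n : N, f n = ∑ g : G, if g ∈ N then f g else 0 := by
  rw [← Finset.sum_filter, Finset.sum_subtype (Finset.univ.filter (· ∈ N)) (p := (· ∈ N))]
  simp

variable [Finite G] [N.Normal] {U W X : Type*} [AddCommGroup U] [Module ℂ U]
  [FiniteDimensional ℂ U] [AddCommGroup W] [Module ℂ W] [FiniteDimensional ℂ W]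
  [AddCommGroup X] [Module ℂ X] [FiniteDimensional ℂ X]

/-- The character of the functions on `G ⧸ N` is the index times the indicator of `N`, so it cuts a
character sum over `G` down to `N`. -/
theorem homDim_res_eq_homDim_tprod (σ : Representation ℂ G U) (τ : Representation ℂ G W) :
    homDim (res N σ) (res N τ) = homDim σ (τ.tprod (permRep G (G ⧸ N))) := by
  classical
  have := Fintype.ofFinite G
  have := Fintype.ofFinite (G ⧸ N)
  have := homDim_congr_sum (σ := res N σ) (τ := res N τ) (σ' := σ)
    (τ' := τ.tprod (permRep G (G ⧸ N))) (a := 1) (b := 1) (by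
      have h1 : ∑ n : N, (res N σ).character n⁻¹ * (res N τ).character n =
          ∑ g : G, if g ∈ N then σ.character g⁻¹ * τ.character g else 0 :=
        sum_subgroup fun g => σ.character g⁻¹ * τ.character g
      rw [h1]
      simp only [char_tensor, Pi.mul_apply, character_permRep_quotient]
      rw [← N.index_mul_card, Finset.mul_sum, Finset.mul_sum]
      refine Finset.sum_congr rfl fun g _ => ?_
      split_ifs
      · push_cast; ring
      · simp)
  simpa using this

/-- The functions on `G ⧸ N` are moved to the side of `τ`; by Frobenius reciprocity they are then
restricted to `N`, where they are `N.index` copies of the trivial module. -/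
theorem homDim_res_ind (φ : Representation ℂ N U) (τ : Representation ℂ G W) :
    homDim (res N (ind N φ)) (res N τ) = N.index * homDim φ (res N τ) := by
  classical
  have := Fintype.ofFinite N
  have := Fintype.ofFinite (G ⧸ N)
  rw [homDim_res_eq_homDim_tprod, homDim_ind]
  have := homDim_congr_sum (σ := φ) (τ := res N (τ.tprod (permRep G (G ⧸ N)))) (σ' := φ)
    (τ' := res N τ) (a := N.index) (b := 1) (by
      rw [Finset.mul_sum, Finset.mul_sum]
      refine Finset.sum_congr rfl fun g _ => ?_
      simp only [character_res, char_tensor, Pi.mul_apply, character_permRep_quotient,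
        SetLike.coe_mem, if_true]
      push_cast
      ring)
  simpa using this

omit [N.Normal] in
theorem homDim_res_regular (φ : Representation ℂ N U) :
    homDim φ (res N (permRep G G)) = N.index * finrank ℂ U := by
  classical
  have := Fintype.ofFinite G
  have h0 : (Nat.card N : ℂ) ≠ 0 := Nat.cast_ne_zero.2 Nat.card_pos.ne'
  have : (homDim φ (res N (permRep G G)) : ℂ) = N.index * finrank ℂ U := by
    apply mul_left_cancel₀ h0
    rw [card_mul_homDim]
    simp only [character_res, character_permRep_self, OneMemClass.coe_eq_one, mul_ite, mul_zero]
    rw [Finset.sum_ite_eq' Finset.univ (1 : N), ← N.index_mul_card]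
    simp
    ring
  exact_mod_cast this

omit [N.Normal] in
theorem ind_equiv_of_homDim {φ : Representation ℂ N U} {ψ : Representation ℂ N W}
    (h : ∀ (n : ℕ) (π : Representation ℂ G (Fin n → ℂ)), π.IsIrreducible →
      homDim φ (res N π) = homDim ψ (res N π)) : Nonempty ((ind N φ).Equiv (ind N ψ)) :=
  equiv_of_homDim_eq _ _ fun n π hπ => by
    rw [homDim_comm, homDim_ind, h n π hπ, ← homDim_ind, homDim_comm]

omit [N.Normal] in
theorem homDim_eq_of_ind_equiv {φ : Representation ℂ N U} {ψ : Representation ℂ N W}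
    (e : (ind N φ).Equiv (ind N ψ)) (τ : Representation ℂ G X) :
    homDim φ (res N τ) = homDim ψ (res N τ) := by
  rw [← homDim_ind, ← homDim_ind, homDim_congr_left (char_iso e)]

omit [Finite G] [FiniteDimensional ℂ U] [FiniteDimensional ℂ W] [FiniteDimensional ℂ X] in
/-- Any two constituents of the restriction of an irreducible representation to a normal subgroup
have the same dimension. -/
theorem finrank_eq_of_constituents {σ : Representation ℂ G X} (hσ : σ.IsIrreducible)
    {φ : Representation ℂ N U} {ψ : Representation ℂ N W} (hφ : φ.IsIrreducible)
    (hψ : ψ.IsIrreducible) (f : φ.IntertwiningMap (res N σ)) (hf : f ≠ 0)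
    (h : (res N σ).IntertwiningMap ψ) (hh : h ≠ 0) : finrank ℂ U = finrank ℂ W := by
  -- Otherwise the intersection of the kernels of all `h ∘ σ g` is a `G`-submodule containing the
  -- image of `f`. It is then everything, and `h = 0`.
  obtain ⟨g, hg⟩ : ∃ g : G, h.toLinearMap ∘ₗ σ g ∘ₗ f.toLinearMap ≠ 0 := by
    by_contra! hc
    let S : Subrepresentation σ :=
      { toSubmodule := ⨅ g : G, LinearMap.ker (h.toLinearMap ∘ₗ σ g)
        apply_mem_toSubmodule := fun g x hx => by
          simp only [Submodule.mem_iInf, LinearMap.mem_ker, LinearMap.comp_apply] at hx ⊢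
          intro k
          have := hx (k * g)
          rwa [map_mul] at this }
    rcases hσ.eq_bot_or_eq_top S with hS | hS
    · apply hf
      refine IntertwiningMap.ext (LinearMap.ext fun x => ?_)
      have hx : f x ∈ S.toSubmodule := by
        simp only [S, Submodule.mem_iInf, LinearMap.mem_ker]
        exact fun g => LinearMap.congr_fun (hc g) x
      rw [hS] at hx
      exact hx
    · apply hh
      refine IntertwiningMap.ext (LinearMap.ext fun x => ?_)
      have hx : x ∈ S.toSubmodule := by rw [hS]; trivial
      simp only [S, Submodule.mem_iInf, LinearMap.mem_ker] at hx
      simpa using hx 1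
  -- `F` commutes with `N` only up to conjugation by `g`. That suffices for its kernel and range to
  -- be submodules, so Schur's argument makes it bijective.
  set F := h.toLinearMap ∘ₗ σ g ∘ₗ f.toLinearMap with hF
  have hFn : ∀ (n : N) (x : U), ∃ m : N, F (φ n x) = ψ m (F x) := fun n x => by
    refine ⟨⟨g * n * g⁻¹, ‹N.Normal›.conj_mem n n.2 g⟩, ?_⟩
    have h1 : f (φ n x) = σ n (f x) := f.isIntertwining _ _ n x
    have h2 := h.isIntertwining _ _ ⟨g * n * g⁻¹, ‹N.Normal›.conj_mem n n.2 g⟩ (σ g (f x))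
    change h (σ g (f (φ n x))) = ψ _ (h (σ g (f x)))
    rw [h1, ← h2]
    change _ = h (σ (g * n * g⁻¹) (σ g (f x)))
    rw [← Module.End.mul_apply, ← Module.End.mul_apply, ← map_mul, ← map_mul,
      inv_mul_cancel_right]
  have hFm : ∀ (n : N) (x : U), ∃ m : N, ψ n (F x) = F (φ m x) := fun n x => by
    have hm : g⁻¹ * n * g ∈ N := by
      simpa using ‹N.Normal›.conj_mem n n.2 g⁻¹
    refine ⟨⟨g⁻¹ * n * g, hm⟩, ?_⟩
    have h1 : f (φ ⟨g⁻¹ * n * g, hm⟩ x) = σ (g⁻¹ * n * g) (f x) := f.isIntertwining _ _ _ x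
    have h2 : h (σ n (σ g (f x))) = ψ n (h (σ g (f x))) := h.isIntertwining _ _ n (σ g (f x))
    change ψ n (h (σ g (f x))) = h (σ g (f (φ _ x)))
    rw [h1, ← h2, ← Module.End.mul_apply, ← Module.End.mul_apply, ← map_mul, ← map_mul]
    congr 3
    group
  have hker : LinearMap.ker F = ⊥ := by
    let S : Subrepresentation φ := ⟨LinearMap.ker F, fun n x hx => by
      obtain ⟨m, hm⟩ := hFn n x
      rw [LinearMap.mem_ker] at hx ⊢
      rw [hm, hx, map_zero]⟩
    rcases hφ.eq_bot_or_eq_top S with hS | hS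
    · exact congrArg Subrepresentation.toSubmodule hS
    · exact absurd (LinearMap.ker_eq_top.1 (congrArg Subrepresentation.toSubmodule hS)) hg
  have hrange : LinearMap.range F = ⊤ := by
    let S : Subrepresentation ψ := ⟨LinearMap.range F, fun n x hx => by
      obtain ⟨y, rfl⟩ := hx
      obtain ⟨m, hm⟩ := hFm n y
      exact ⟨_, hm.symm⟩⟩
    rcases hψ.eq_bot_or_eq_top S with hS | hS
    · exact absurd (LinearMap.range_eq_bot.1 (congrArg Subrepresentation.toSubmodule hS)) hg
    · exact congrArg Subrepresentation.toSubmodule hS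
  exact (LinearEquiv.ofBijective F
    ⟨LinearMap.ker_eq_bot.1 hker, LinearMap.range_eq_top.1 hrange⟩).finrank_eq

end Restriction

/-! ### Clifford correspondence between restricted and induced systems -/

section Systems

variable {G : Type v} [Group G] [Finite G] {N : Subgroup G}
  {I : Type w} {J : Type w'} {ρ : I → Rep.{u} ℂ G} {φ : J → Rep.{u} ℂ N}

omit [Finite G] in
theorem IsRestrictedSystem.exists_equiv (hρ : IsRestrictedSystem N ρ) {U : Type*}
    [AddCommGroup U] [Module ℂ U] [FiniteDimensional ℂ U] {σ : Representation ℂ G U}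
    (hσ : σ.IsIrreducible) : ∃ i, Nonempty ((res N σ).Equiv (res N (ρ i).ρ)) := by
  -- `complete` speaks of modules in universe `u`, so the coordinate space is lifted there.
  let e := (finBasis ℂ U).equivFun.trans
    (ULift.moduleEquiv.{0, 0, u} (R := ℂ) (M := Fin (finrank ℂ U) → ℂ)).symm
  have hfd : FiniteDimensional ℂ (ULift.{u} (Fin (finrank ℂ U) → ℂ)) :=
    Module.Finite.equiv e
  obtain ⟨i, ⟨e'⟩⟩ := hρ.complete (Rep.of (transport σ e)) hfd
    (isIrreducible_of_equiv (transportEquiv σ e) hσ)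
  exact ⟨i, ⟨(resEquiv (transportEquiv σ e)).trans e'⟩⟩

theorem IsInducedSystem.exists_equiv (hφ : IsInducedSystem N φ) {U : Type*}
    [AddCommGroup U] [Module ℂ U] [FiniteDimensional ℂ U] {ψ : Representation ℂ N U}
    (hψ : ψ.IsIrreducible) : ∃ j, Nonempty ((ind N ψ).Equiv (ind N (φ j).ρ)) := by
  let e := (finBasis ℂ U).equivFun.trans
    (ULift.moduleEquiv.{0, 0, u} (R := ℂ) (M := Fin (finrank ℂ U) → ℂ)).symm
  have hfd : FiniteDimensional ℂ (ULift.{u} (Fin (finrank ℂ U) → ℂ)) :=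
    Module.Finite.equiv e
  obtain ⟨j, ⟨e'⟩⟩ := hφ.complete (Rep.of (transport ψ e)) hfd
    (isIrreducible_of_equiv (transportEquiv ψ e) hψ)
  obtain ⟨e''⟩ := ind_equiv_of_homDim (φ := ψ) (ψ := transport ψ e) fun n π _ =>
    homDim_congr_left (char_iso (transportEquiv ψ e))
  exact ⟨j, ⟨e''.trans e'⟩⟩

/-- A nonzero map `Res ρᵢ → ψ` followed by an embedding `ψ → Res ρₖ` would be a nonzero map between
disjoint modules. -/
theorem IsRestrictedSystem.eq_of_homDim_ne_zero (hρ : IsRestrictedSystem N ρ) {U : Type*}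
    [AddCommGroup U] [Module ℂ U] [FiniteDimensional ℂ U] {ψ : Representation ℂ N U}
    (hψ : ψ.IsIrreducible) {i k : I} (hi : homDim ψ (res N (ρ i).ρ) ≠ 0)
    (hk : homDim ψ (res N (ρ k).ρ) ≠ 0) : i = k := by
  have := hρ.finiteDimensional i
  have := hρ.finiteDimensional k
  by_contra hik
  rw [homDim_comm] at hi
  obtain ⟨f, hf⟩ := homDim_ne_zero_iff.1 hi
  obtain ⟨g, hg⟩ := (homDim_ne_zero_iff_embeds hψ).1 hk
  apply hf
  have h0 := hρ.disjoint i k hik (g.comp f)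
  refine IntertwiningMap.ext (LinearMap.ext fun x => hg ?_)
  exact (LinearMap.congr_fun (congrArg IntertwiningMap.toLinearMap h0) x).trans (map_zero g).symm

variable [N.Normal]

theorem mul_homDim_of_character {U W X : Type*} [AddCommGroup U] [Module ℂ U]
    [FiniteDimensional ℂ U] {ψ : Representation ℂ N U} [AddCommGroup W] [Module ℂ W]
    [FiniteDimensional ℂ W] {σ : Representation ℂ G W}
    [AddCommGroup X] [Module ℂ X] [FiniteDimensional ℂ X] {k : ℕ}
    (hk : ∀ n : N, (ind N ψ).character n = k * σ.character n) (τ : Representation ℂ G X) :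
    k * homDim (res N σ) (res N τ) = N.index * homDim ψ (res N τ) := by
  have := Fintype.ofFinite N
  rw [← homDim_res_ind]
  simpa using homDim_congr_sum (σ := res N σ) (τ := res N τ) (σ' := res N (ind N ψ))
    (τ' := res N τ) (a := 1) (b := k) (by
      rw [Finset.mul_sum, Finset.mul_sum]
      refine Finset.sum_congr rfl fun n _ => ?_
      have := hk n⁻¹
      simp only [character_res, InvMemClass.coe_inv] at this ⊢
      rw [this]
      push_cast
      ring)

-- Here `k` is the number of irreducible constituents of `Ind ψ`: each of them contains `ψ` on
-- restriction, hence restricts like `ρᵢ`.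
omit [N.Normal] in
theorem IsRestrictedSystem.exists_character_ind (hρ : IsRestrictedSystem N ρ) {U : Type*}
    [AddCommGroup U] [Module ℂ U] [FiniteDimensional ℂ U] {ψ : Representation ℂ N U}
    (hψ : ψ.IsIrreducible) {i : I} (hi : homDim ψ (res N (ρ i).ρ) ≠ 0) :
    ∃ k : ℕ, ∀ n : N, (ind N ψ).character n = k * (ρ i).ρ.character n := by
  have := hρ.finiteDimensional i
  obtain ⟨k, n, π, h1, h2⟩ := character_eq_sum_irreducible (ind N ψ)
  have h3 : ∀ a, (res N (π a)).character = (res N (ρ i).ρ).character := fun a => by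
    obtain ⟨l, ⟨e⟩⟩ := hρ.exists_equiv (h1 a).1
    have := hρ.finiteDimensional l
    have h4 : homDim ψ (res N (ρ l).ρ) ≠ 0 := by
      rw [← homDim_congr_right (char_iso e), ← homDim_ind, homDim_comm,
        homDim_ne_zero_iff_embeds (h1 a).1]
      exact (h1 a).2
    rw [char_iso e, hρ.eq_of_homDim_ne_zero hψ hi h4]
  refine ⟨k, fun n => ?_⟩
  rw [h2]
  refine (Finset.sum_congr rfl fun a _ => congrFun (h3 a) n).trans ?_
  rw [Finset.sum_const, Finset.card_univ, Fintype.card_fin, nsmul_eq_mul]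
  rfl

/-- Multiplicities of an `N`-constituent of an irreducible `G`-module, against `G`-modules. -/
theorem IsRestrictedSystem.finrank_mul_homDim (hρ : IsRestrictedSystem N ρ) {U X : Type*}
    [AddCommGroup U] [Module ℂ U] [FiniteDimensional ℂ U] {ψ : Representation ℂ N U}
    [AddCommGroup X] [Module ℂ X] [FiniteDimensional ℂ X]
    (hψ : ψ.IsIrreducible) {i : I} (hi : homDim ψ (res N (ρ i).ρ) ≠ 0)
    (τ : Representation ℂ G X) :
    finrank ℂ U * homDim (res N (ρ i).ρ) (res N τ) =
      finrank ℂ (ρ i) * homDim ψ (res N τ) := by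
  have := hρ.finiteDimensional i
  have := Fintype.ofFinite G
  obtain ⟨k, hk⟩ := hρ.exists_character_ind hψ hi
  have key := mul_homDim_of_character hk τ
  -- Against the regular module the identity becomes `k · dim ρᵢ = |G:N| · dim ψ`, which eliminates
  -- `k`.
  have hreg := mul_homDim_of_character hk (permRep G G)
  have hU := finrank_pos_of_isIrreducible hψ
  have hN : 0 < N.index := Nat.pos_of_ne_zero N.index_ne_zero_of_finite
  rw [homDim_res_regular, homDim_res_regular, mul_left_comm] at hreg
  have hreg := Nat.eq_of_mul_eq_mul_left hN hreg
  have hk0 : 0 < k := by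
    refine Nat.pos_of_ne_zero fun h => ?_
    rw [h, zero_mul] at hreg
    exact (Nat.mul_pos hN hU).ne hreg
  apply Nat.eq_of_mul_eq_mul_left hk0
  calc _ = finrank ℂ U * (k * homDim (res N (ρ i).ρ) (res N τ)) := by ring
    _ = (N.index * finrank ℂ U) * homDim ψ (res N τ) := by rw [key]; ring
    _ = _ := by rw [← hreg]; ring

theorem IsRestrictedSystem.finrank_eq (hρ : IsRestrictedSystem N ρ) {U W : Type*}
    [AddCommGroup U] [Module ℂ U] [FiniteDimensional ℂ U] {ψ : Representation ℂ N U}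
    [AddCommGroup W] [Module ℂ W] [FiniteDimensional ℂ W] {ψ' : Representation ℂ N W}
    (hψ : ψ.IsIrreducible) (hψ' : ψ'.IsIrreducible) {i : I} (hi : homDim ψ (res N (ρ i).ρ) ≠ 0)
    (hi' : homDim ψ' (res N (ρ i).ρ) ≠ 0) : finrank ℂ U = finrank ℂ W := by
  have := hρ.finiteDimensional i
  obtain ⟨f, hf⟩ := homDim_ne_zero_iff.1 hi
  rw [homDim_comm] at hi'
  obtain ⟨h, hh⟩ := homDim_ne_zero_iff.1 hi'
  exact finrank_eq_of_constituents (hρ.irreducible i) hψ hψ' f hf h hh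

omit [N.Normal] in
theorem IsRestrictedSystem.existsUnique_restricted (hρ : IsRestrictedSystem N ρ)
    (hφ : IsInducedSystem N φ) (j : J) : ∃! i, homDim (φ j).ρ (res N (ρ i).ρ) ≠ 0 := by
  have := Fintype.ofFinite G
  have := hφ.finiteDimensional j
  have hN : 0 < N.index := Nat.pos_of_ne_zero N.index_ne_zero_of_finite
  have hreg : homDim (ind N (φ j).ρ) (permRep G G) ≠ 0 := by
    rw [homDim_ind, homDim_res_regular]
    exact (Nat.mul_pos hN (finrank_pos_of_isIrreducible (hφ.irreducible j))).ne'
  obtain ⟨f, hf⟩ := homDim_ne_zero_iff.1 hreg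
  have hnt : Nontrivial (Representation.IndV N.subtype (φ j).ρ) := by
    by_contra hc
    rw [not_nontrivial_iff_subsingleton] at hc
    refine hf (IntertwiningMap.ext (LinearMap.ext fun x => ?_))
    rw [Subsingleton.elim x 0, map_zero, map_zero]
  obtain ⟨n, π, hπ, hemb⟩ := exists_irreducible_embedding (ind N (φ j).ρ)
  obtain ⟨i, ⟨e⟩⟩ := hρ.exists_equiv hπ
  have := hρ.finiteDimensional i
  refine ⟨i, ?_, fun k hk => ?_⟩
  · beta_reduce
    rw [← homDim_congr_right (char_iso e), ← homDim_ind, homDim_comm]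
    exact (homDim_ne_zero_iff_embeds hπ).2 hemb
  · refine hρ.eq_of_homDim_ne_zero (hφ.irreducible j) hk ?_
    rw [← homDim_congr_right (char_iso e), ← homDim_ind, homDim_comm]
    exact (homDim_ne_zero_iff_embeds hπ).2 hemb

/-- Two constituents of `Res ρᵢ` have equal dimension, so by `finrank_mul_homDim` equal multiplicity
in every restricted module; they then induce isomorphic modules. -/
theorem IsRestrictedSystem.existsUnique_induced (hρ : IsRestrictedSystem N ρ)
    (hφ : IsInducedSystem N φ) (i : I) : ∃! j, homDim (φ j).ρ (res N (ρ i).ρ) ≠ 0 := by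
  have := hρ.finiteDimensional i
  have := nontrivial_of_isIrreducible (hρ.irreducible i)
  obtain ⟨n, ψ, hψ, hemb⟩ := exists_irreducible_embedding (res N (ρ i).ρ)
  obtain ⟨j, ⟨e⟩⟩ := hφ.exists_equiv hψ
  have := hφ.finiteDimensional j
  have hj : homDim (φ j).ρ (res N (ρ i).ρ) ≠ 0 := by
    rw [← homDim_eq_of_ind_equiv e]
    exact (homDim_ne_zero_iff_embeds hψ).2 hemb
  refine ⟨j, hj, fun k hk => ?_⟩
  by_contra hkj
  have := hφ.finiteDimensional k
  have hdim := hρ.finrank_eq (hφ.irreducible k) (hφ.irreducible j) hk hj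
  obtain ⟨e'⟩ := ind_equiv_of_homDim (φ := (φ k).ρ) (ψ := (φ j).ρ) fun n π _ => by
    have h1 := hρ.finrank_mul_homDim (hφ.irreducible k) hk π
    have h2 := hρ.finrank_mul_homDim (hφ.irreducible j) hj π
    rw [hdim, h2] at h1
    exact (Nat.eq_of_mul_eq_mul_left (finrank_pos_of_isIrreducible (hρ.irreducible i)) h1).symm
  exact (hφ.distinct k j hkj).false e'

theorem IsRestrictedSystem.exists_bijection (hρ : IsRestrictedSystem N ρ)
    (hφ : IsInducedSystem N φ) :
    ∃ f : I ≃ J, ∀ i j, f i = j ↔ homDim (φ j).ρ (res N (ρ i).ρ) ≠ 0 := by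
  choose f hf hf' using hρ.existsUnique_induced hφ
  choose g hg hg' using hρ.existsUnique_restricted hφ
  refine ⟨⟨f, g, fun i => (hg' _ _ (hf i)).symm, fun j => (hf' _ _ (hg j)).symm⟩,
    fun i j => ⟨?_, fun h => (hf' i j h).symm⟩⟩
  rintro rfl
  exact hf i

omit [N.Normal] in
theorem corresponds_iff (hρ : IsRestrictedSystem N ρ) (hφ : IsInducedSystem N φ) (i : I) (j : J) :
    Corresponds N (ρ i) (φ j) ↔ homDim (φ j).ρ (res N (ρ i).ρ) ≠ 0 := by
  have := hρ.finiteDimensional i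
  have := hφ.finiteDimensional j
  rw [Corresponds, ← homDim_ne_zero_iff_embeds (hρ.irreducible i),
    ← homDim_ne_zero_iff_embeds (hφ.irreducible j), homDim_comm, homDim_ind, and_self]

end Systems

/-! ### Clifford theory in prime index -/

section PrimeIndex

variable {G : Type v} [Group G] {N : Subgroup G}

/-- The twist of a representation by a linear character. -/
def twist {U : Type*} [AddCommGroup U] [Module ℂ U] (c : G →* ℂ) (σ : Representation ℂ G U) :
    Representation ℂ G U where
  toFun g := c g • σ g
  map_one' := by simp
  map_mul' g h := by simp [smul_smul, mul_comm (c g)]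

theorem character_twist {U : Type*} [AddCommGroup U] [Module ℂ U] (c : G →* ℂ)
    (σ : Representation ℂ G U) (g : G) : (twist c σ).character g = c g * σ.character g := by
  simp [character, twist]

theorem isIrreducible_twist {U : Type*} [AddCommGroup U] [Module ℂ U] (c : G →* ℂ)
    {σ : Representation ℂ G U} (hσ : σ.IsIrreducible) : (twist c σ).IsIrreducible := by
  have := nontrivial_of_isIrreducible hσ
  refine isIrreducible_of_forall fun S hS => ?_
  let T : Subrepresentation σ := ⟨S.toSubmodule, fun g x hx => by
    have h0 : c g ≠ 0 := ((Group.isUnit g).map c).ne_zero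
    have h1 : c g • σ g x ∈ S.toSubmodule := S.apply_mem_toSubmodule g hx
    rwa [Submodule.smul_mem_iff _ h0] at h1⟩
  exact congrArg Subrepresentation.toSubmodule
    ((hσ.eq_bot_or_eq_top T).resolve_left fun h => hS (congrArg Subrepresentation.toSubmodule h))

theorem exists_character_of_prime_index [Finite G] [N.Normal] {p : ℕ} (hp : p.Prime)
    (hN : N.index = p) : ∃ c : G →* ℂ, (∀ g, c g ^ p = 1) ∧ ∀ g, c g = 1 ↔ g ∈ N := by
  have : Fact p.Prime := ⟨hp⟩
  have hcard : Nat.card (G ⧸ N) = p := hN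
  have hcyc : IsCyclic (G ⧸ N) := isCyclic_of_prime_card hcard
  let _ : CommGroup (G ⧸ N) := IsCyclic.commGroup
  have : Nontrivial (G ⧸ N) := by
    rw [← Finite.one_lt_card_iff_nontrivial, hcard]
    exact hp.one_lt
  obtain ⟨a, ha⟩ := exists_ne (1 : G ⧸ N)
  obtain ⟨χ, hχ⟩ := CommGroup.exists_apply_ne_one_of_hasEnoughRootsOfUnity (G ⧸ N) ℂ ha
  have hker : χ.ker = ⊥ := by
    have : Fact (Nat.card (G ⧸ N)).Prime := ⟨hcard ▸ hp⟩
    refine (Subgroup.eq_bot_or_eq_top_of_prime_card χ.ker).resolve_right fun h => hχ ?_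
    rw [← MonoidHom.mem_ker, h]
    trivial
  refine ⟨(Units.coeHom ℂ).comp (χ.comp (QuotientGroup.mk' N)), fun g => ?_, fun g => ?_⟩
  · rw [← map_pow]
    simp only [MonoidHom.comp_apply, map_pow]
    rw [← map_pow, ← map_pow, ← hcard, pow_card_eq_one', map_one, map_one]
  · simp only [MonoidHom.comp_apply, Units.coeHom_apply, Units.val_eq_one, QuotientGroup.mk'_apply]
    rw [← MonoidHom.mem_ker, hker, Subgroup.mem_bot, QuotientGroup.eq_one_iff]

/-- With `c` a faithful character of `G ⧸ N`, the dimension is the sum over `k < p` of `homDim σ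
(twist (c ^ k) σ)`. If only `k = 0` contributes, it is `1`. Otherwise `σ ≅ cᵏ ⊗ σ` for some `0 < k <
p`, the character of `σ` vanishes off `N`, and the norm over `N` is `p` times that over `G`. -/
theorem homDim_res_self_of_prime_index [Finite G] [N.Normal] {p : ℕ} (hp : p.Prime)
    (hN : N.index = p) {U : Type*} [AddCommGroup U] [Module ℂ U] [FiniteDimensional ℂ U]
    {σ : Representation ℂ G U} (hσ : σ.IsIrreducible) :
    homDim (res N σ) (res N σ) = 1 ∨ homDim (res N σ) (res N σ) = p := by
  classical
  have := Fintype.ofFinite G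
  obtain ⟨c, hc1, hc2⟩ := exists_character_of_prime_index hp hN
  have hN0 : (Nat.card N : ℂ) ≠ 0 := Nat.cast_ne_zero.2 Nat.card_pos.ne'
  have hp0 : (p : ℂ) ≠ 0 := Nat.cast_ne_zero.2 hp.ne_zero
  have hcardG : (Nat.card G : ℂ) = p * Nat.card N := by
    rw [← N.index_mul_card, hN, Nat.cast_mul]
  have hE : (Nat.card N : ℂ) * homDim (res N σ) (res N σ) =
      ∑ g : G, if g ∈ N then σ.character g⁻¹ * σ.character g else 0 := by
    rw [card_mul_homDim]
    exact sum_subgroup fun g => σ.character g⁻¹ * σ.character g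
  have hself : homDim σ σ = 1 := IsIrreducible.finrank_intertwiningMap_self σ
  by_cases h : ∃ k, 0 < k ∧ k < p ∧ homDim σ (twist (c ^ k) σ) ≠ 0
  · right
    obtain ⟨k, hk0, hkp, hk⟩ := h
    obtain ⟨e⟩ := equiv_of_homDim_ne_zero hσ (isIrreducible_twist _ hσ) hk
    have hvan : ∀ g, g ∉ N → σ.character g = 0 := fun g hg => by
      have h1 := congrFun (char_iso e) g
      rw [character_twist, MonoidHom.pow_apply, eq_comm, mul_left_eq_self₀] at h1
      -- Both `c g ^ k = 1` and `c g ^ p = 1` hold with `k` and `p` coprime, so `c g = 1`.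
      refine h1.resolve_left fun h2 => hg ((hc2 g).1 ?_)
      rw [← orderOf_eq_one_iff]
      exact Nat.eq_one_of_dvd_coprimes (Nat.coprime_of_lt_prime hk0.ne' hkp hp)
        (orderOf_dvd_of_pow_eq_one (hc1 g)) (orderOf_dvd_of_pow_eq_one h2)
    have h2 : (Nat.card G : ℂ) * homDim σ σ = Nat.card N * homDim (res N σ) (res N σ) := by
      rw [hE, card_mul_homDim]
      refine Finset.sum_congr rfl fun g _ => ?_
      split_ifs with hg
      · rfl
      · rw [hvan g hg, mul_zero]
    rw [hself, hcardG, mul_comm (p : ℂ), mul_assoc] at h2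
    have h3 := mul_left_cancel₀ hN0 h2
    rw [Nat.cast_one, mul_one] at h3
    exact_mod_cast h3.symm
  · left
    push Not at h
    have h2 : (Nat.card G : ℂ) * ∑ k ∈ Finset.range p, (homDim σ (twist (c ^ k) σ) : ℂ) =
        Nat.card G * homDim (res N σ) (res N σ) := by
      rw [hcardG, mul_assoc (p : ℂ), mul_assoc (p : ℂ), hE, ← mul_assoc, ← hcardG, Finset.mul_sum]
      simp only [card_mul_homDim, character_twist, MonoidHom.pow_apply]
      rw [Finset.sum_comm, Finset.mul_sum]
      refine Finset.sum_congr rfl fun g _ => ?_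
      rw [← Finset.mul_sum, ← Finset.sum_mul]
      split_ifs with hg
      · simp only [(hc2 g).2 hg, one_pow, Finset.sum_const, Finset.card_range, nsmul_eq_mul,
          mul_one]
        ring
      · have h3 : ∑ k ∈ Finset.range p, c g ^ k = 0 := by
          have h4 := geom_sum_mul (c g) p
          rw [hc1, sub_self] at h4
          exact (mul_eq_zero.1 h4).resolve_right (sub_ne_zero.2 fun h5 => hg ((hc2 g).1 h5))
        rw [h3, zero_mul, mul_zero, mul_zero]
    have h3 := mul_left_cancel₀ (Nat.cast_ne_zero.2 Nat.card_pos.ne') h2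
    rw [Finset.sum_eq_single_of_mem 0 (Finset.mem_range.2 hp.pos)] at h3
    · have h4 : homDim σ (twist (c ^ 0) σ) = 1 := by
        rw [← hself]
        refine homDim_congr_right (funext fun g => ?_)
        rw [character_twist, pow_zero, MonoidHom.one_apply, one_mul]
      rw [h4] at h3
      exact_mod_cast h3.symm
    · intro k hk hk0
      rw [h k (Nat.pos_of_ne_zero hk0) (Finset.mem_range.1 hk), Nat.cast_zero]

variable [Finite G] [N.Normal] {I : Type w} {ρ : I → Rep.{u} ℂ G}

/-- For a normal subgroup of prime index, the restriction of an irreducible module is multiplicity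
free, and has one or `p` constituents. -/
theorem IsRestrictedSystem.multiplicity_of_prime_index (hρ : IsRestrictedSystem N ρ) {p : ℕ}
    (hp : p.Prime) (hN : N.index = p) {U : Type*} [AddCommGroup U] [Module ℂ U]
    [FiniteDimensional ℂ U] {ψ : Representation ℂ N U} (hψ : ψ.IsIrreducible) {i : I}
    (hi : homDim ψ (res N (ρ i).ρ) ≠ 0) :
    homDim ψ (res N (ρ i).ρ) = 1 ∧
      (finrank ℂ (ρ i) = finrank ℂ U ∨ finrank ℂ (ρ i) = p * finrank ℂ U) := by
  have := hρ.finiteDimensional i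
  obtain ⟨k, n, π, h1, h2⟩ := character_eq_sum_irreducible (res N (ρ i).ρ)
  have hU := finrank_pos_of_isIrreducible hψ
  have hdim : finrank ℂ (ρ i) = k * finrank ℂ U := by
    have h3 := h2 1
    simp only [char_one] at h3
    rw [Finset.sum_congr rfl fun a _ => congrArg Nat.cast (hρ.finrank_eq (h1 a).1 hψ
      ((homDim_ne_zero_iff_embeds (h1 a).1).2 (h1 a).2) hi)] at h3
    simp only [Finset.sum_const, Finset.card_univ, Fintype.card_fin, nsmul_eq_mul] at h3
    exact_mod_cast h3
  have hle : homDim ψ (res N (ρ i).ρ) ≤ k := by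
    rw [homDim_comm, homDim_sum π ψ h2]
    refine (Finset.sum_le_sum fun a _ => homDim_le_one (h1 a).1 hψ).trans ?_
    simp
  -- With `k` constituents of equal dimension and `e` the multiplicity of `ψ`, this reads `dim
  -- End_N(Res ρᵢ) = k * e`. That number is `1` or `p`, and `e ≤ k`, so `e = 1`.
  have hE := hρ.finrank_mul_homDim hψ hi (ρ i).ρ
  rw [hdim, mul_comm k, mul_assoc] at hE
  have hE := Nat.eq_of_mul_eq_mul_left hU hE
  generalize homDim ψ (res N (ρ i).ρ) = e at *
  rcases homDim_res_self_of_prime_index hp hN (hρ.irreducible i) with h | h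
  · rw [h] at hE
    obtain ⟨rfl, rfl⟩ : k = 1 ∧ e = 1 := mul_eq_one.1 hE.symm
    exact ⟨rfl, .inl (by rw [hdim, one_mul])⟩
  · rw [h] at hE
    rcases (Nat.dvd_prime hp).1 ⟨e, hE⟩ with rfl | rfl
    · have := hp.one_lt
      omega
    · have : e = 1 := by
        have h5 := hp.pos
        nlinarith [Nat.eq_of_mul_eq_mul_left h5 (hE.symm.trans (mul_one _).symm)]
      exact ⟨this, .inr hdim⟩

end PrimeIndex

section RootLengths

variable {J : Type*} [DecidableEq J] {B : Matrix J J ℕ} {d : J → ℝ}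

theorem isRootLength_cartan_iff :
    IsRootLength (cartan B) d ↔ (∀ i, 0 < d i) ∧ ∀ i j, d i * B i j = d j * B j i := by
  refine and_congr_right fun _ => forall_congr' fun i => forall_congr' fun j => ?_
  by_cases h : i = j
  · subst h; simp
  · have h1 : (2 : Matrix J J ℤ) i j = 0 := Matrix.diagonal_apply_ne _ h
    have h2 : (2 : Matrix J J ℤ) j i = 0 := Matrix.diagonal_apply_ne _ (Ne.symm h)
    simp [cartan, h1, h2]

end RootLengths

instance {U : Type*} [AddCommGroup U] [Module ℂ U] [FiniteDimensional ℂ U] (k : ℕ) :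
    FiniteDimensional ℂ (⨂[ℂ]^k U) :=
  Module.Basis.finiteDimensional_of_finite
    (Basis.piTensorProduct fun _ : Fin k => finBasis ℂ U)

/-! ### Comparison of Poincaré series, and moving `V` across Hom -/

section Series

variable {G : Type v} [Group G] [Finite G] {N : Subgroup G} [N.Normal]
  {I : Type w} {J : Type w'} {ρ : I → Rep.{u} ℂ G} {φ : J → Rep.{u} ℂ N}
  {U : Type*} [AddCommGroup U] [Module ℂ U] [FiniteDimensional ℂ U]
  {V : Representation ℂ G U}

theorem IsRestrictedSystem.homDim_res (hρ : IsRestrictedSystem N ρ) (hφ : IsInducedSystem N φ)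
    {i : I} {j : J} (h : homDim (φ j).ρ (res N (ρ i).ρ) ≠ 0) {r : ℕ}
    (hr : finrank ℂ (ρ i) = r * finrank ℂ (φ j)) {X : Type*} [AddCommGroup X] [Module ℂ X]
    [FiniteDimensional ℂ X] (τ : Representation ℂ G X) :
    homDim (res N (ρ i).ρ) (res N τ) = r * homDim (φ j).ρ (res N τ) := by
  have := hφ.finiteDimensional j
  have h1 := hρ.finrank_mul_homDim (hφ.irreducible j) h τ
  rw [hr, mul_comm r, mul_assoc] at h1
  exact Nat.eq_of_mul_eq_mul_left (finrank_pos_of_isIrreducible (hφ.irreducible j)) h1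

theorem IsRestrictedSystem.resSeries_eq (hρ : IsRestrictedSystem N ρ) (hφ : IsInducedSystem N φ)
    {i : I} {j : J} (h : homDim (φ j).ρ (res N (ρ i).ρ) ≠ 0) {r : ℕ}
    (hr : finrank ℂ (ρ i) = r * finrank ℂ (φ j)) :
    resSeries N V (ρ i) = r • indSeries N V (φ j) := by
  ext k
  rw [map_nsmul, smul_eq_mul, resSeries, indSeries, PowerSeries.coeff_mk, PowerSeries.coeff_mk]
  exact (hρ.homDim_res hφ h hr (tensorPower V k)).trans
    (congrArg _ (homDim_ind N (φ j).ρ (tensorPower V k)).symm)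

omit [N.Normal] [Finite G] in
theorem IsRestrictedSystem.exists_trivial (hρ : IsRestrictedSystem N ρ) :
    ∃ i, Nonempty ((res N (Representation.trivial ℂ G ℂ)).Equiv (res N (ρ i).ρ)) := by
  refine hρ.exists_equiv (isIrreducible_of_forall fun S hS => ?_)
  exact (eq_bot_or_eq_top S.toSubmodule).resolve_left hS

omit [N.Normal] in
theorem homDim_tprod_ind (hV : ∀ g, V.character g⁻¹ = V.character g) {X Y : Type*}
    [AddCommGroup X] [Module ℂ X] [FiniteDimensional ℂ X] [AddCommGroup Y] [Module ℂ Y]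
    [FiniteDimensional ℂ Y] (ψ : Representation ℂ N X) (π : Representation ℂ G Y) :
    homDim π (V.tprod (ind N ψ)) = homDim ψ (res N (V.tprod π)) := by
  rw [← homDim_ind, homDim_comm (σ := ind N ψ)]
  refine homDim_congr fun g => ?_
  simp only [char_tensor, Pi.mul_apply, hV]
  ring

omit [N.Normal] in
theorem homDim_tprod_comm (hV : ∀ g, V.character g⁻¹ = V.character g) {X Y : Type*}
    [AddCommGroup X] [Module ℂ X] [FiniteDimensional ℂ X] [AddCommGroup Y] [Module ℂ Y]
    [FiniteDimensional ℂ Y] (σ : Representation ℂ G X) (τ : Representation ℂ G Y) :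
    homDim (res N (V.tprod σ)) (res N τ) = homDim (res N σ) (res N (V.tprod τ)) := by
  refine homDim_congr fun g => ?_
  have := hV g
  simp only [character_res, char_tensor, Pi.mul_apply, InvMemClass.coe_inv, this]
  ring

variable [Fintype J]

omit [N.Normal] in
theorem IsInducedSystem.homDim_directSum (hφ : IsInducedSystem N φ) (b : J → ℕ) {X : Type*}
    [AddCommGroup X] [Module ℂ X] [FiniteDimensional ℂ X] (π : Representation ℂ G X) :
    homDim π (Representation.directSum fun p : (Σ i, Fin (b i)) => ind N (φ p.1).ρ) =
      ∑ i, b i * homDim (φ i).ρ (res N π) := by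
  have := hφ.finiteDimensional
  rw [McKaySlodowy.homDim_directSum, Fintype.sum_sigma]
  refine Finset.sum_congr rfl fun i _ => ?_
  rw [← homDim_ind N (φ i).ρ π, homDim_comm]
  refine (Finset.sum_const (homDim π (ind N (φ i).ρ))).trans ?_
  simp

end Series

/-! ### Adjacency matrix and root lengths in prime index -/

section PrimeIndex

variable {G : Type v} [Group G] [Finite G] {N : Subgroup G} [N.Normal]
  {I : Type w} {J : Type w'} [Fintype J] {ρ : I → Rep.{u} ℂ G} {φ : J → Rep.{u} ℂ N}
  {U : Type*} [AddCommGroup U] [Module ℂ U] [FiniteDimensional ℂ U]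
  {V : Representation ℂ G U} {f : I ≃ J} {p : ℕ}

/-- Only `φ (f k)` occurs in `Res ρₖ`, and it does so once; irreducible `G`-modules thus read off
the coefficients `b`, which gives both uniqueness and existence of `B`. -/
theorem homDim_directSum_restricted (hρ : IsRestrictedSystem N ρ) (hφ : IsInducedSystem N φ)
    (hf : ∀ i j, f i = j ↔ homDim (φ j).ρ (res N (ρ i).ρ) ≠ 0) (hp : p.Prime) (hN : N.index = p)
    (b : J → ℕ) {X : Type*} [AddCommGroup X] [Module ℂ X] [FiniteDimensional ℂ X]
    {π : Representation ℂ G X} {k : I} (e : (res N π).Equiv (res N (ρ k).ρ)) :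
    homDim π (Representation.directSum fun p : (Σ i, Fin (b i)) => ind N (φ p.1).ρ) = b (f k) := by
  have := hφ.finiteDimensional
  have := hρ.finiteDimensional
  rw [hφ.homDim_directSum b π]
  simp only [homDim_congr_right (char_iso e)]
  rw [Finset.sum_eq_single (f k)]
  · rw [(hρ.multiplicity_of_prime_index hp hN (hφ.irreducible _) ((hf k _).1 rfl)).1, mul_one]
  · intro j _ hj
    rw [not_not.1 (mt (hf k j).2 hj.symm), mul_zero]
  · simp

theorem IsAdjacencyMatrix.apply_eq (hρ : IsRestrictedSystem N ρ) (hφ : IsInducedSystem N φ)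
    (hf : ∀ i j, f i = j ↔ homDim (φ j).ρ (res N (ρ i).ρ) ≠ 0) (hp : p.Prime) (hN : N.index = p)
    (hV : ∀ g, V.character g⁻¹ = V.character g) {B : Matrix J J ℕ}
    (hB : IsAdjacencyMatrix N V φ B) (k : I) (j : J) :
    B (f k) j = homDim (φ j).ρ (res N (V.tprod (ρ k).ρ)) := by
  have := hφ.finiteDimensional
  have := hρ.finiteDimensional
  obtain ⟨e⟩ := hB j
  rw [← homDim_tprod_ind hV, homDim_congr_right (char_iso e),
    homDim_directSum_restricted hρ hφ hf hp hN (fun i => B i j) (.refl _)]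

theorem exists_isAdjacencyMatrix (hρ : IsRestrictedSystem N ρ) (hφ : IsInducedSystem N φ)
    (hf : ∀ i j, f i = j ↔ homDim (φ j).ρ (res N (ρ i).ρ) ≠ 0) (hp : p.Prime) (hN : N.index = p)
    (hV : ∀ g, V.character g⁻¹ = V.character g) :
    ∃ B : Matrix J J ℕ, IsAdjacencyMatrix N V φ B := by
  have := hφ.finiteDimensional
  have := hρ.finiteDimensional
  refine ⟨fun i j => homDim (φ j).ρ (res N (V.tprod (ρ (f.symm i)).ρ)), fun j => ?_⟩
  refine equiv_of_homDim_eq _ _ fun n π hπ => ?_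
  obtain ⟨k, ⟨e⟩⟩ := hρ.exists_equiv hπ
  rw [homDim_directSum_restricted hρ hφ hf hp hN
    (fun i => homDim (φ j).ρ (res N (V.tprod (ρ (f.symm i)).ρ))) e, homDim_tprod_ind hV,
    f.symm_apply_apply]
  refine homDim_congr_right (funext fun g => ?_)
  have := congrFun (char_iso e) g
  simp only [character_res, char_tensor, Pi.mul_apply] at this ⊢
  rw [this]

variable {r : I → ℕ}

/-- Both sides are `dim Hom_N(Res ρ_l, Res (V ⊗ ρ_k))`, which is symmetric in `k` and `l` because
`V` is self-dual. -/
theorem IsAdjacencyMatrix.mul_apply_comm (hρ : IsRestrictedSystem N ρ) (hφ : IsInducedSystem N φ)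
    (hf : ∀ i j, f i = j ↔ homDim (φ j).ρ (res N (ρ i).ρ) ≠ 0) (hp : p.Prime) (hN : N.index = p)
    (hV : ∀ g, V.character g⁻¹ = V.character g)
    (hr : ∀ i, finrank ℂ (ρ i) = r i * finrank ℂ (φ (f i))) {B : Matrix J J ℕ}
    (hB : IsAdjacencyMatrix N V φ B) (k l : I) :
    r l * B (f k) (f l) = r k * B (f l) (f k) := by
  have := hρ.finiteDimensional
  rw [hB.apply_eq hρ hφ hf hp hN hV, hB.apply_eq hρ hφ hf hp hN hV,
    ← hρ.homDim_res hφ ((hf l _).1 rfl) (hr l), ← hρ.homDim_res hφ ((hf k _).1 rfl) (hr k),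
    homDim_comm, homDim_tprod_comm hV]

/-- The invariant `d (f l) * r l` of a vector of root lengths is constant along the graph. -/
theorem exists_power_of_rootLength (hρ : IsRestrictedSystem N ρ) (hφ : IsInducedSystem N φ)
    (hf : ∀ i j, f i = j ↔ homDim (φ j).ρ (res N (ρ i).ρ) ≠ 0) (hp : p.Prime) (hN : N.index = p)
    (hV : ∀ g, V.character g⁻¹ = V.character g)
    (hr : ∀ i, finrank ℂ (ρ i) = r i * finrank ℂ (φ (f i))) (hr0 : ∀ i, r i ≠ 0)
    {B : Matrix J J ℕ} (hB : IsAdjacencyMatrix N V φ B) {d : J → ℝ}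
    (hd : ∀ i j, d i * B i j = d j * B j i) {i₀ : I}
    (e₀ : (res N (Representation.trivial ℂ G ℂ)).Equiv (res N (ρ i₀).ρ)) (k : ℕ) :
    ∃ (m : ℕ) (W : Representation ℂ G (Fin m → ℂ)), (∀ g, W.character g = V.character g ^ k) ∧
      ∀ l, homDim (res N W) (res N (ρ l).ρ) ≠ 0 → d (f l) * r l = d (f i₀) * r i₀ := by
  have := hφ.finiteDimensional
  have := hρ.finiteDimensional
  induction k with
  | zero =>
    let e := (finBasis ℂ ℂ).equivFun
    refine ⟨_, transport (Representation.trivial ℂ G ℂ) e, fun g => ?_, fun l hl => ?_⟩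
    · rw [← char_iso (transportEquiv _ e), pow_zero]
      simp [character, Representation.trivial]
    · rw [← homDim_congr_left (char_iso (resEquiv (transportEquiv _ e))),
        homDim_congr_left (char_iso e₀)] at hl
      obtain ⟨F, hF⟩ := homDim_ne_zero_iff.1 hl
      by_cases h : i₀ = l
      · rw [h]
      · exact absurd (hρ.disjoint _ _ h F) hF
  | succ k ih =>
    obtain ⟨m, W, hW, hWl⟩ := ih
    let e := (finBasis ℂ (U ⊗[ℂ] (Fin m → ℂ))).equivFun
    refine ⟨_, transport (V.tprod W) e, fun g => ?_, fun l hl => ?_⟩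
    · rw [← char_iso (transportEquiv _ e), char_tensor, Pi.mul_apply, hW, pow_succ']
    · rw [← homDim_congr_left (char_iso (resEquiv (transportEquiv _ e))),
        homDim_tprod_comm hV] at hl
      -- Some constituent of `Res W` also lies in `V ⊗ ρ_l`. It belongs to a vertex `f b` adjacent
      -- to `f l`, and `ρ_b` meets `W`, so the induction hypothesis applies to `b`.
      obtain ⟨q, n, π, h1, h2⟩ := character_eq_sum_irreducible (res N W)
      rw [homDim_sum π _ h2] at hl
      obtain ⟨a, -, ha⟩ := Finset.exists_ne_zero_of_sum_ne_zero hl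
      obtain ⟨j, ⟨e'⟩⟩ := hφ.exists_equiv (h1 a).1
      obtain ⟨b, rfl⟩ := f.surjective j
      rw [homDim_eq_of_ind_equiv e', ← hB.apply_eq hρ hφ hf hp hN hV] at ha
      have hb : homDim (res N (ρ b).ρ) (res N W) ≠ 0 := by
        rw [hρ.homDim_res hφ ((hf b _).1 rfl) (hr b), ← homDim_eq_of_ind_equiv e']
        exact mul_ne_zero (hr0 b) ((homDim_ne_zero_iff_embeds (h1 a).1).2 (h1 a).2)
      rw [homDim_comm] at hb
      rw [← hWl b hb]
      have hsym := hB.mul_apply_comm hρ hφ hf hp hN hV hr l b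
      have hsym' : (r b : ℝ) * B (f l) (f b) = r l * B (f b) (f l) := by exact_mod_cast hsym
      have hne : (B (f b) (f l) : ℝ) ≠ 0 := by
        intro h0
        rw [h0, mul_zero, mul_eq_zero] at hsym'
        exact hsym'.elim (Nat.cast_ne_zero.2 (hr0 b)) (Nat.cast_ne_zero.2 ha)
      apply mul_right_cancel₀ hne
      have := hd (f l) (f b)
      linear_combination (r b : ℝ) * this - d (f l) * hsym'

/-- Burnside's argument. If the equality failed at `l`, then `Res ρ_l` would meet no tensor power of
`V`, so the character of `ρ_l` would be orthogonal on `N` to every polynomial in that of `V`. As `V`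
is faithful, some polynomial isolates the identity, where the character of `ρ_l` is its nonzero
dimension. -/
theorem rootLength_mul_eq (hρ : IsRestrictedSystem N ρ) (hφ : IsInducedSystem N φ)
    (hf : ∀ i j, f i = j ↔ homDim (φ j).ρ (res N (ρ i).ρ) ≠ 0) (hp : p.Prime) (hN : N.index = p)
    (hV : ∀ g, V.character g⁻¹ = V.character g)
    (hV1 : ∀ g, V.character g = V.character 1 → g = 1)
    (hr : ∀ i, finrank ℂ (ρ i) = r i * finrank ℂ (φ (f i))) (hr0 : ∀ i, r i ≠ 0)
    {B : Matrix J J ℕ} (hB : IsAdjacencyMatrix N V φ B) {d : J → ℝ}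
    (hd : ∀ i j, d i * B i j = d j * B j i) {i₀ : I}
    (e₀ : (res N (Representation.trivial ℂ G ℂ)).Equiv (res N (ρ i₀).ρ)) (l : I) :
    d (f l) * r l = d (f i₀) * r i₀ := by
  classical
  have := Fintype.ofFinite N
  have := hρ.finiteDimensional l
  by_contra hl
  have hpow : ∀ k, ∑ n : N, V.character n ^ k * (ρ l).ρ.character n = 0 := fun k => by
    obtain ⟨m, W, hW, hWl⟩ :=
      exists_power_of_rootLength hρ hφ hf hp hN hV hr hr0 hB hd e₀ k
    have h0 := not_not.1 (mt (hWl l) hl)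
    have h1 := card_mul_homDim (res N W) (res N (ρ l).ρ)
    rw [h0, Nat.cast_zero, mul_zero] at h1
    rw [h1]
    refine Finset.sum_congr rfl fun n _ => ?_
    rw [character_res, character_res, hW, InvMemClass.coe_inv, hV]
  have hpoly : ∀ P : Polynomial ℂ,
      ∑ n : N, P.eval (V.character n) * (ρ l).ρ.character n = 0 := fun P => by
    induction P using Polynomial.induction_on' with
    | add P Q hP hQ => simp only [Polynomial.eval_add, add_mul, Finset.sum_add_distrib, hP, hQ,
        add_zero]
    | monomial k a => simp only [Polynomial.eval_monomial, mul_assoc, ← Finset.mul_sum, hpow,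
        mul_zero]
  have h := hpoly (∏ n ∈ Finset.univ.erase (1 : N), (Polynomial.X - .C (V.character n)))
  rw [Finset.sum_eq_single 1] at h
  · simp only [OneMemClass.coe_one, mul_eq_zero, Polynomial.eval_prod, Finset.prod_eq_zero_iff,
      Polynomial.eval_sub, Polynomial.eval_X, Polynomial.eval_C, Finset.mem_erase,
      Finset.mem_univ, and_true, sub_eq_zero] at h
    rcases h with ⟨n, hn, h⟩ | h
    · exact hn (Subtype.ext (hV1 _ h.symm))
    · rw [char_one, Nat.cast_eq_zero] at h
      exact (finrank_pos_of_isIrreducible (hρ.irreducible l)).ne' h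
  · intro n _ hn
    rw [Polynomial.eval_prod, Finset.prod_eq_zero (i := n) (by simp [hn]) (by simp), zero_mul]
  · simp

theorem long_short_of_prime_index [DecidableEq J] (hρ : IsRestrictedSystem N ρ)
    (hφ : IsInducedSystem N φ)
    (hf : ∀ i j, f i = j ↔ homDim (φ j).ρ (res N (ρ i).ρ) ≠ 0) (hp : p.Prime) (hN : N.index = p)
    (hV : ∀ g, V.character g⁻¹ = V.character g)
    (hV1 : ∀ g, V.character g = V.character 1 → g = 1)
    {B : Matrix J J ℕ} (hB : IsAdjacencyMatrix N V φ B) (i : I) :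
    (IsLongRoot (cartan B) (f i) ∨ IsShortRoot (cartan B) (f i)) ∧
      (IsLongRoot (cartan B) (f i) → finrank ℂ (ρ i) = 1 * finrank ℂ (φ (f i))) ∧
      (IsShortRoot (cartan B) (f i) → finrank ℂ (ρ i) = p * finrank ℂ (φ (f i))) := by
  have := hφ.finiteDimensional
  have := hρ.finiteDimensional
  have hex : ∀ i, ∃ r : ℕ, (r = 1 ∨ r = p) ∧ finrank ℂ (ρ i) = r * finrank ℂ (φ (f i)) :=
    fun i => by
      rcases (hρ.multiplicity_of_prime_index hp hN (hφ.irreducible _) ((hf i _).1 rfl)).2 with h | h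
      · exact ⟨1, .inl rfl, by rw [h, one_mul]⟩
      · exact ⟨p, .inr rfl, h⟩
  choose r hr1 hr using hex
  have hr0 : ∀ i, 0 < r i := fun i => by
    rcases hr1 i with h | h <;> rw [h]
    exacts [one_pos, hp.pos]
  have hr0' : ∀ i, r i ≠ 0 := fun i => (hr0 i).ne'
  have hrp : ∀ i, (r i : ℝ) ≤ p := fun i => by
    rcases hr1 i with h | h <;> rw [h]
    exact_mod_cast hp.one_lt.le
  have hp1 : (1 : ℝ) < p := by exact_mod_cast hp.one_lt
  have hr1' : ∀ i, (1 : ℝ) ≤ r i := fun i => by exact_mod_cast hr0 i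
  obtain ⟨i₀, ⟨e₀⟩⟩ := hρ.exists_trivial
  have hi₀ : r i₀ = 1 := by
    have h1 := finrank_eq_of_equiv e₀
    rw [finrank_self, hr] at h1
    exact Nat.eq_one_of_mul_eq_one_right h1.symm
  -- By `mul_apply_comm` the reciprocals of the ratios symmetrize the Cartan matrix; `huniq` says
  -- that every other choice is proportional to this one.
  have hlen : IsRootLength (cartan B) fun j => (r (f.symm j) : ℝ)⁻¹ := by
    rw [isRootLength_cartan_iff]
    refine ⟨fun j => inv_pos.2 (Nat.cast_pos.2 (hr0 _)), fun i j => ?_⟩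
    have h := hB.mul_apply_comm hρ hφ hf hp hN hV hr (f.symm i) (f.symm j)
    rw [f.apply_symm_apply, f.apply_symm_apply] at h
    have h' : (r (f.symm j) : ℝ) * B i j = r (f.symm i) * B j i := by exact_mod_cast h
    have h1 : (r (f.symm i) : ℝ) ≠ 0 := Nat.cast_ne_zero.2 (hr0' _)
    have h2 : (r (f.symm j) : ℝ) ≠ 0 := Nat.cast_ne_zero.2 (hr0' _)
    field_simp
    linear_combination h'
  have huniq : ∀ d : J → ℝ, IsRootLength (cartan B) d → ∀ l, d (f l) * r l = d (f i₀) :=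
    fun d hd l => by
      rw [rootLength_mul_eq hρ hφ hf hp hN hV hV1 hr hr0' hB (isRootLength_cartan_iff.1 hd).2 e₀ l,
        hi₀, Nat.cast_one, mul_one]
  refine ⟨?_, ?_, ?_⟩
  · rcases hr1 i with h | h
    · refine .inl ⟨_, hlen, fun j => ?_⟩
      simp only [f.symm_apply_apply, h, Nat.cast_one, inv_one]
      exact inv_le_one_of_one_le₀ (hr1' _)
    · refine .inr ⟨_, hlen, fun j => ?_, f i₀, ?_⟩
      · simp only [f.symm_apply_apply, h]
        exact inv_anti₀ (Nat.cast_pos.2 (hr0 _)) (hrp _)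
      · simp only [f.symm_apply_apply, h, hi₀, Nat.cast_one, inv_one]
        exact inv_lt_one_of_one_lt₀ hp1
  · rintro ⟨d, hd, hmax⟩
    have h1 := huniq d hd i
    have h2 := hmax (f i₀)
    rcases hr1 i with h | h
    · rw [hr i, h]
    · rw [h] at h1
      nlinarith [hd.1 (f i)]
  · rintro ⟨d, hd, hmin, j, hj⟩
    rcases hr1 i with h | h
    · have h1 := huniq d hd i
      have h2 := huniq d hd (f.symm j)
      rw [h, Nat.cast_one, mul_one] at h1
      rw [f.apply_symm_apply] at h2
      nlinarith [hd.1 j, hr1' (f.symm j)]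
    · rw [hr i, h]

end PrimeIndex

/-! ### Extensions of a subgroup with cyclic quotient -/

section Extension

variable {Γ : Type*} [Group Γ] {S : Set Γ} {g : Γ} {p : ℕ}

/-- Conjugation by `g⁻¹` also preserves the subgroup: it is conjugation by `g ^ (p - 1)` followed by
conjugation by the inverse of the member `g ^ p`. -/
theorem mem_normalizer_closure (hp : 0 < p) (hS : ∀ s ∈ S, g * s * g⁻¹ ∈ Subgroup.closure S)
    (hg : g ^ p ∈ Subgroup.closure S) : g ∈ Subgroup.normalizer (Subgroup.closure S : Set Γ) := by
  have h1 : ∀ x ∈ Subgroup.closure S, g * x * g⁻¹ ∈ Subgroup.closure S := fun x hx => by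
    have : Subgroup.closure S ≤ (Subgroup.closure S).comap (MulAut.conj g).toMonoidHom := by
      rw [Subgroup.closure_le]
      exact fun s hs => hS s hs
    exact this hx
  have hk : ∀ k : ℕ, ∀ x ∈ Subgroup.closure S, g ^ k * x * (g ^ k)⁻¹ ∈ Subgroup.closure S := by
    intro k
    induction k with
    | zero => intro x hx; simpa using hx
    | succ k ih =>
      intro x hx
      have := h1 _ (ih x hx)
      rwa [show g * (g ^ k * x * (g ^ k)⁻¹) * g⁻¹ = g ^ (k + 1) * x * (g ^ (k + 1))⁻¹ by
        rw [pow_succ']; group] at this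
  rw [Subgroup.mem_normalizer_iff]
  refine fun x => ⟨h1 x, fun hx => ?_⟩
  have h2 := hk (p - 1) _ hx
  have h3 : g ^ (p - 1) * (g * x * g⁻¹) * (g ^ (p - 1))⁻¹ = g ^ p * x * (g ^ p)⁻¹ := by
    obtain ⟨q, rfl⟩ : ∃ q, p = q + 1 := ⟨p - 1, by omega⟩
    rw [Nat.add_sub_cancel, pow_succ]
    group
  rw [h3] at h2
  have h4 := mul_mem (mul_mem (inv_mem hg) h2) hg
  rwa [show (g ^ p)⁻¹ * (g ^ p * x * (g ^ p)⁻¹) * g ^ p = x by group] at h4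

variable {N G : Subgroup Γ}

theorem normal_subgroupOf_of_closure {S T : Set Γ} (hN : N = Subgroup.closure S)
    (hG : G = Subgroup.closure T)
    (h : ∀ g ∈ T, ∃ p : ℕ, 0 < p ∧ (∀ s ∈ S, g * s * g⁻¹ ∈ N) ∧ g ^ p ∈ N) (hle : N ≤ G) :
    (N.subgroupOf G).Normal := by
  rw [Subgroup.normal_subgroupOf_iff_le_normalizer hle, hG, Subgroup.closure_le]
  intro g hg
  obtain ⟨p, hp, h1, h2⟩ := h g hg
  subst hN
  exact mem_normalizer_closure hp h1 h2

/-- A subgroup `G` generated by `N` and an element `g` normalizing `N` with `g ^ p ∈ N`. -/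
structure IsCyclicExtension (N G : Subgroup Γ) (g : Γ) (p : ℕ) : Prop where
  le : N ≤ G
  mem : g ∈ G
  le_of_le : ∀ K : Subgroup Γ, N ≤ K → g ∈ K → G ≤ K
  normal : (N.subgroupOf G).Normal
  pow_mem : g ^ p ∈ N

theorem isCyclicExtension_of_closure (hp : 0 < p) (hN : N = Subgroup.closure S)
    (hG : G = Subgroup.closure (insert g S)) (hS : ∀ s ∈ S, g * s * g⁻¹ ∈ N) (hg : g ^ p ∈ N) :
    IsCyclicExtension N G g p := by
  have hmem : g ∈ G := hG ▸ Subgroup.subset_closure (Set.mem_insert _ _)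
  have hle : N ≤ G := by
    rw [hN, hG]
    exact Subgroup.closure_mono (Set.subset_insert _ _)
  refine ⟨hle, hmem, fun K hNK hgK => ?_, ?_, hg⟩
  · rw [hG, Subgroup.closure_le, Set.insert_subset_iff]
    exact ⟨hgK, fun s hs => hNK (hN ▸ Subgroup.subset_closure hs)⟩
  · refine normal_subgroupOf_of_closure hN hG (fun h hh => ?_) hle
    rcases hh with rfl | hh
    · exact ⟨p, hp, hS, hg⟩
    · have hhN : h ∈ N := hN ▸ Subgroup.subset_closure hh
      exact ⟨1, one_pos, fun s hs => mul_mem (mul_mem hhN (hN ▸ Subgroup.subset_closure hs))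
        (inv_mem hhN), pow_mem hhN 1⟩

namespace IsCyclicExtension

variable (h : IsCyclicExtension N G g p)

include h

theorem exists_zpow [(N.subgroupOf G).Normal] (x : G ⧸ N.subgroupOf G) :
    x ∈ Subgroup.zpowers ((⟨g, h.mem⟩ : G) : G ⧸ N.subgroupOf G) := by
  induction x using QuotientGroup.induction_on with
  | _ x =>
  let H := (Subgroup.zpowers ((⟨g, h.mem⟩ : G) : G ⧸ N.subgroupOf G)).comap
    (QuotientGroup.mk' (N.subgroupOf G))
  have hK := h.le_of_le (H.map G.subtype) (fun n hn => ⟨⟨n, h.le hn⟩, ?_, rfl⟩)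
    ⟨⟨g, h.mem⟩, Subgroup.mem_zpowers _, rfl⟩
  · obtain ⟨y, hy, hyx⟩ := hK x.2
    rw [Subtype.ext hyx] at hy
    exact hy
  · have h1 : ((⟨n, h.le hn⟩ : G) : G ⧸ N.subgroupOf G) = 1 :=
      (QuotientGroup.eq_one_iff _).2 hn
    change ((⟨n, h.le hn⟩ : G) : G ⧸ N.subgroupOf G) ∈ Subgroup.zpowers _
    rw [h1]
    exact one_mem _

theorem mk_pow [(N.subgroupOf G).Normal] :
    ((⟨g, h.mem⟩ : G) : G ⧸ N.subgroupOf G) ^ p = 1 := by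
  rw [← QuotientGroup.mk_pow, QuotientGroup.eq_one_iff]
  exact h.pow_mem

theorem index_eq_of_prime (hp : p.Prime) (hg : g ∉ N) : (N.subgroupOf G).index = p := by
  have := h.normal
  have : Fact p.Prime := ⟨hp⟩
  rw [Subgroup.index, ← orderOf_eq_card_of_forall_mem_zpowers h.exists_zpow]
  exact orderOf_eq_prime h.mk_pow fun h1 =>
    hg ((QuotientGroup.eq_one_iff (N := N.subgroupOf G) _).1 h1)

theorem finite (hp : 0 < p) [Finite N] : Finite G := by
  have := h.normal
  have hc : Nat.card (G ⧸ N.subgroupOf G) ≠ 0 := by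
    rw [← orderOf_eq_card_of_forall_mem_zpowers h.exists_zpow]
    exact (orderOf_pos_iff.2 (isOfFinOrder_iff_pow_eq_one.2 ⟨p, hp, h.mk_pow⟩)).ne'
  have : Finite (N.subgroupOf G) := Finite.of_equiv N (Subgroup.subgroupOfEquivOfLe h.le).symm
  have hc' : Nat.card G ≠ 0 := by
    rw [Subgroup.card_eq_card_quotient_mul_card_subgroup (N.subgroupOf G)]
    exact mul_ne_zero hc Nat.card_pos.ne'
  exact Nat.finite_of_card_ne_zero hc'

end IsCyclicExtension

end Extension

/-! ### Relations between the generators -/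

section Relations

theorem theta_two_mul_sq (m : ℕ) : theta (2 * m) ^ 2 = theta m := by
  rw [theta, theta, ← Complex.exp_nat_mul]
  congr 1
  rcases eq_or_ne m 0 with rfl | hm
  · simp
  · have : (m : ℂ) ≠ 0 := Nat.cast_ne_zero.2 hm
    push_cast
    field_simp

theorem theta_two_mul_pow {m : ℕ} (hm : m ≠ 0) : theta (2 * m) ^ m = -1 := by
  rw [theta, ← Complex.exp_nat_mul, ← Complex.exp_pi_mul_I]
  congr 1
  have : (m : ℂ) ≠ 0 := Nat.cast_ne_zero.2 hm
  push_cast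
  field_simp

theorem theta_four : theta 4 = Complex.I := by
  refine Eq.trans ?_ Complex.exp_pi_div_two_mul_I
  rw [theta]
  congr 1
  push_cast
  ring

theorem theta_eight : theta 8 = ((Real.sqrt 2 : ℝ) : ℂ)⁻¹ * (1 + Complex.I) := by
  have h : theta 8 = Complex.exp ((Real.pi / 4 : ℝ) * Complex.I) := by
    rw [theta]
    congr 1
    push_cast
    ring
  have h2 : ((Real.sqrt 2 : ℝ) : ℂ) / 2 = ((Real.sqrt 2 : ℝ) : ℂ)⁻¹ := by
    have h3 := half_add_half
    have h4 : ((Real.sqrt 2 : ℝ) : ℂ) ≠ 0 := by simp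
    field_simp at h3 ⊢
    linear_combination -h3
  rw [h, Complex.exp_mul_I, ← Complex.ofReal_cos, ← Complex.ofReal_sin, Real.cos_pi_div_four,
    Real.sin_pi_div_four]
  push_cast
  rw [h2]
  ring

theorem theta_eight_inv : (theta 8)⁻¹ = ((Real.sqrt 2 : ℝ) : ℂ)⁻¹ * (1 - Complex.I) := by
  refine inv_eq_of_mul_eq_one_right ?_
  rw [theta_eight]
  linear_combination half_add_half - ((Real.sqrt 2 : ℝ) : ℂ)⁻¹ ^ 2 * Complex.I_sq

theorem coe_rot (n : ℕ) : (rot n : Matrix (Fin 2) (Fin 2) ℂ) = !![(theta n)⁻¹, 0; 0, theta n] :=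
  rfl

theorem coe_rot_inv (n : ℕ) :
    ((rot n)⁻¹ : SU2).1 = !![theta n, 0; 0, (theta n)⁻¹] := by
  have : (rot n)⁻¹ = ⟨!![theta n, 0; 0, (theta n)⁻¹], by
      have h := (star (rot n)).2
      convert h using 1
      ext i j
      have := star_theta n
      fin_cases i <;> fin_cases j <;> simp_all [coe_rot]⟩ := by
    rw [inv_eq_iff_mul_eq_one]
    have := theta_ne_zero n
    ext i j
    fin_cases i <;> fin_cases j <;> simp [coe_rot, this]
  rw [this]

theorem coe_matY : (matY : Matrix (Fin 2) (Fin 2) ℂ) = !![0, Complex.I; Complex.I, 0] := rfl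

theorem coe_matX : (matX : Matrix (Fin 2) (Fin 2) ℂ) = !![Complex.I, 0; 0, -Complex.I] := rfl

theorem coe_matZ : (matZ : Matrix (Fin 2) (Fin 2) ℂ) =
    !![(1 - Complex.I) / 2, (1 - Complex.I) / 2; -(1 + Complex.I) / 2, (1 + Complex.I) / 2] := by
  have h : ((Real.sqrt 2 : ℝ) : ℂ)⁻¹ * ((Real.sqrt 2 : ℝ) : ℂ)⁻¹ = 1 / 2 := by
    linear_combination half_add_half / 2
  change ((Real.sqrt 2 : ℝ) : ℂ)⁻¹ • !![(theta 8)⁻¹, (theta 8)⁻¹; -theta 8, theta 8] = _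
  rw [theta_eight_inv, theta_eight]
  ext i j
  fin_cases i <;> fin_cases j <;> simp [← mul_assoc, h] <;> ring

theorem coe_pow_rot (n k : ℕ) :
    ((rot n ^ k : SU2) : Matrix (Fin 2) (Fin 2) ℂ) = !![(theta n)⁻¹ ^ k, 0; 0, theta n ^ k] := by
  induction k with
  | zero => ext i j; fin_cases i <;> fin_cases j <;> simp
  | succ k ih =>
    rw [pow_succ, Submonoid.coe_mul, ih, coe_rot]
    ext i j
    fin_cases i <;> fin_cases j <;> simp [pow_succ]

theorem rot_two_mul_sq (m : ℕ) : rot (2 * m) ^ 2 = rot m := by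
  apply Subtype.ext
  rw [coe_pow_rot, coe_rot, inv_pow, theta_two_mul_sq]

theorem rot_two_mul_pow {m : ℕ} (hm : m ≠ 0) : rot (2 * m) ^ m = matY ^ 2 := by
  apply Subtype.ext
  rw [coe_pow_rot, inv_pow, theta_two_mul_pow hm, pow_two, Submonoid.coe_mul, coe_matY]
  ext i j
  fin_cases i <;> fin_cases j <;> simp [inv_neg]

theorem matY_mul_rot (n : ℕ) : matY * rot n * matY⁻¹ = (rot n)⁻¹ := by
  rw [mul_inv_eq_iff_eq_mul]
  apply Subtype.ext
  rw [Submonoid.coe_mul, Submonoid.coe_mul, coe_rot_inv, coe_rot, coe_matY]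
  ext i j
  fin_cases i <;> fin_cases j <;> simp [mul_comm]

theorem rot_mul_matY (n : ℕ) : rot n * matY * (rot n)⁻¹ = rot n ^ 2 * matY := by
  have h := matY_mul_rot n
  rw [mul_inv_eq_iff_eq_mul] at h ⊢
  rw [pow_two, mul_assoc, mul_assoc, h, mul_inv_cancel_left]

theorem matX_eq : matX = (rot 4)⁻¹ := by
  apply Subtype.ext
  rw [coe_rot_inv, theta_four, coe_matX, Complex.inv_I]

theorem rot_eight_inv_sq : ((rot 8)⁻¹) ^ 2 = matX := by
  rw [inv_pow, show (8 : ℕ) = 2 * 4 from rfl, rot_two_mul_sq, matX_eq]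

theorem matZ_mul_matX : matZ * matX * matZ⁻¹ = matX * matY := by
  rw [mul_inv_eq_iff_eq_mul]
  apply Subtype.ext
  simp only [Submonoid.coe_mul, coe_matX, coe_matY, coe_matZ]
  ext i j
  fin_cases i <;> fin_cases j <;> simp <;> ring_nf <;> simp <;> ring

theorem matZ_mul_matY : matZ * matY * matZ⁻¹ = matX := by
  rw [mul_inv_eq_iff_eq_mul]
  apply Subtype.ext
  simp only [Submonoid.coe_mul, coe_matX, coe_matY, coe_matZ]
  ext i j
  fin_cases i <;> fin_cases j <;> simp <;> ring

theorem matZ_pow : matZ ^ 3 = matX ^ 2 := by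
  apply Subtype.ext
  simp only [pow_succ, pow_zero, one_mul, Submonoid.coe_mul, coe_matX, coe_matZ]
  ext i j
  fin_cases i <;> fin_cases j <;> simp <;> ring_nf <;> simp <;> ring

theorem matY_sq : matY ^ 2 = matX ^ 2 := by
  apply Subtype.ext
  simp only [pow_two, Submonoid.coe_mul, coe_matX, coe_matY]
  ext i j
  fin_cases i <;> fin_cases j <;> simp

theorem rot_eight_inv_mul_matY : (rot 8)⁻¹ * matY * ((rot 8)⁻¹)⁻¹ = matX * matY := by
  have h := matY_mul_rot 8
  rw [mul_inv_eq_iff_eq_mul] at h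
  rw [inv_inv, mul_assoc, h, ← rot_eight_inv_sq, pow_two, mul_assoc]

theorem rot_eight_inv_mul_matZ : (rot 8)⁻¹ * matZ * ((rot 8)⁻¹)⁻¹ = matX * matZ ^ 2 := by
  rw [mul_inv_eq_iff_eq_mul]
  apply Subtype.ext
  have h : ((Real.sqrt 2 : ℝ) : ℂ)⁻¹ * ((Real.sqrt 2 : ℝ) : ℂ)⁻¹ = 1 / 2 := by
    linear_combination half_add_half / 2
  simp only [pow_two, Submonoid.coe_mul, coe_matX, coe_matZ, coe_rot_inv,
    theta_eight_inv]
  simp only [theta_eight]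
  generalize ((Real.sqrt 2 : ℝ) : ℂ)⁻¹ = s at h
  ext i j
  fin_cases i <;> fin_cases j <;> simp <;> ring_nf <;> simp <;> ring

end Relations

/-! ### Elements outside the normal subgroups -/

section Membership

theorem coe_inv_SU2 (g : SU2) (i j : Fin 2) : (g⁻¹ : SU2).1 i j = star (g.1 j i) := rfl

/-- Monomial matrices whose nonzero entries satisfy a power condition. -/
def IsMonomial (m : ℕ) (g : SU2) : Prop :=
  (g.1 0 1 = 0 ∧ g.1 1 0 = 0 ∧ g.1 0 0 ^ (2 * m) = 1 ∧ g.1 1 1 ^ (2 * m) = 1) ∨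
  (g.1 0 0 = 0 ∧ g.1 1 1 = 0 ∧ g.1 0 1 ^ (2 * m) = (-1) ^ m ∧ g.1 1 0 ^ (2 * m) = (-1) ^ m)

/-- The sign `(-1) ^ m` for antidiagonal matrices is `i ^ (2m)`, from `matY`; in a product of two
such matrices it squares to `1`. -/
theorem isMonomial_of_mem_binDihedral {m : ℕ} (hm : m ≠ 0) {g : SU2} (hg : g ∈ binDihedral m) :
    IsMonomial m g := by
  have hsq : ((-1 : ℂ) ^ m) * (-1) ^ m = 1 := by
    rw [← mul_pow]
    norm_num
  induction hg using Subgroup.closure_induction with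
  | mem x hx =>
    rcases hx with rfl | rfl
    · have h : theta (2 * m) ^ (2 * m) = 1 := by
        rw [mul_comm 2 m, pow_mul, mul_comm m 2, theta_two_mul_pow hm]
        norm_num
      exact .inl (by simp [coe_rot, h])
    · exact .inr (by simp [coe_matY, pow_mul])
  | one => exact .inl (by simp)
  | mul x y _ _ hx hy =>
    rcases hx with ⟨h1, h2, h3, h4⟩ | ⟨h1, h2, h3, h4⟩ <;>
      rcases hy with ⟨k1, k2, k3, k4⟩ | ⟨k1, k2, k3, k4⟩
    · exact .inl (by simp [Matrix.mul_apply, mul_pow, h1, h2, h3, h4, k1, k2, k3, k4])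
    · exact .inr (by simp [Matrix.mul_apply, mul_pow, h1, h2, h3, h4, k1, k2, k3, k4])
    · exact .inr (by simp [Matrix.mul_apply, mul_pow, h1, h2, h3, h4, k1, k2, k3, k4])
    · exact .inl (by simp [Matrix.mul_apply, mul_pow, h1, h2, h3, h4, k1, k2, k3, k4, hsq])
  | inv x _ hx =>
    rcases hx with ⟨h1, h2, h3, h4⟩ | ⟨h1, h2, h3, h4⟩
    · exact .inl (by simp only [coe_inv_SU2, ← star_pow, h1, h2, h3, h4]; simp)
    · exact .inr (by simp only [coe_inv_SU2, ← star_pow, h1, h2, h3, h4]; simp)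

theorem rot_notMem_binDihedral {m : ℕ} (hm : m ≠ 0) : rot (2 * (2 * m)) ∉ binDihedral m := by
  intro h
  rcases isMonomial_of_mem_binDihedral hm h with ⟨-, -, -, h⟩ | ⟨h, -⟩
  · have h1 : theta (2 * (2 * m)) ^ (2 * m) = 1 := h
    rw [theta_two_mul_pow (by omega)] at h1
    norm_num at h1
  · exact inv_ne_zero (theta_ne_zero _) h

theorem matZ_notMem_binDihedral {m : ℕ} (hm : m ≠ 0) : matZ ∉ binDihedral m := by
  have hI : (1 - Complex.I) / 2 ≠ 0 := by
    intro h
    have := congrArg Complex.re h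
    simp at this
  intro h
  rcases isMonomial_of_mem_binDihedral hm h with ⟨h, -⟩ | ⟨h, -⟩ <;>
    rw [coe_matZ] at h <;> exact hI h

theorem matY_notMem_cyclic (n : ℕ) : matY ∉ cyclic n := by
  have key : ∀ g ∈ cyclic n, g.1 0 1 = 0 ∧ g.1 1 0 = 0 := fun g hg => by
    induction hg using Subgroup.closure_induction with
    | mem x hx => rw [Set.mem_singleton_iff.1 hx]; simp [coe_rot]
    | one => simp
    | mul x y _ _ hx hy => simp [Matrix.mul_apply, hx, hy]
    | inv x _ hx => simp [coe_inv_SU2, hx]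
  exact fun h => Complex.I_ne_zero (key _ h).1

/-- All entries of elements of `T` lie in `ℚ(i)`, whereas the real part of `θ₈` is irrational. -/
theorem rot_eight_notMem_binTetrahedral : (rot 8)⁻¹ ∉ binTetrahedral := by
  have key : ∀ g ∈ binTetrahedral, ∀ i j, ∃ a b : ℚ, g.1 i j = a + b * Complex.I := fun g hg => by
    induction hg using Subgroup.closure_induction with
    | mem x hx =>
      have h0 : ∃ a b : ℚ, (0 : ℂ) = a + b * Complex.I := ⟨0, 0, by simp⟩
      have hI : ∃ a b : ℚ, Complex.I = a + b * Complex.I := ⟨0, 1, by simp⟩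
      rcases hx with rfl | rfl | rfl
      · intro i j
        fin_cases i <;> fin_cases j
        exacts [hI, h0, h0, ⟨0, -1, by simp [coe_matX]⟩]
      · intro i j
        fin_cases i <;> fin_cases j
        exacts [h0, hI, hI, h0]
      · rw [coe_matZ]
        intro i j
        fin_cases i <;> fin_cases j
        exacts [⟨1 / 2, -1 / 2, by simp; ring⟩, ⟨1 / 2, -1 / 2, by simp; ring⟩,
          ⟨-1 / 2, -1 / 2, by simp; ring⟩, ⟨1 / 2, 1 / 2, by simp; ring⟩]
    | one =>
      intro i j
      fin_cases i <;> fin_cases j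
      exacts [⟨1, 0, by simp⟩, ⟨0, 0, by simp⟩, ⟨0, 0, by simp⟩, ⟨1, 0, by simp⟩]
    | mul x y _ _ hx hy =>
      intro i j
      obtain ⟨a, b, h1⟩ := hx i 0
      obtain ⟨a', b', h2⟩ := hx i 1
      obtain ⟨c, d, h3⟩ := hy 0 j
      obtain ⟨c', d', h4⟩ := hy 1 j
      refine ⟨a * c - b * d + (a' * c' - b' * d'), a * d + b * c + (a' * d' + b' * c'), ?_⟩
      simp only [Submonoid.coe_mul, Matrix.mul_apply, Fin.sum_univ_two, h1, h2, h3, h4]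
      push_cast
      linear_combination (b * d + b' * d' : ℂ) * Complex.I_sq
    | inv x _ hx =>
      intro i j
      obtain ⟨a, b, h⟩ := hx j i
      refine ⟨a, -b, ?_⟩
      rw [coe_inv_SU2, h]
      simp
  intro h
  obtain ⟨a, b, hab⟩ := key _ h 0 0
  have h1 : theta 8 = a + b * Complex.I := by rwa [coe_rot_inv] at hab
  rw [theta_eight, ← Complex.ofReal_inv] at h1
  have h2 := congrArg Complex.re h1
  simp at h2
  exact irrational_sqrt_two ⟨2 * a, by push_cast; linarith⟩

end Membership

/-! ### Finiteness, normality and index for the listed pairs -/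

section Pairs

theorem finite_cyclic {n : ℕ} (hn : n ≠ 0) : Finite (cyclic (2 * n)) := by
  rw [cyclic, ← Subgroup.zpowers_eq_closure]
  have h4 : matY ^ 4 = 1 := by
    rw [show matY ^ 4 = (matX ^ 2) ^ 2 by rw [← matY_sq, ← pow_mul]]
    apply Subtype.ext
    simp only [pow_two, Submonoid.coe_mul, coe_matX]
    ext i j
    fin_cases i <;> fin_cases j <;> simp
  have : IsOfFinOrder (rot (2 * n)) := isOfFinOrder_iff_pow_eq_one.2
    ⟨n * 2, by omega, by rw [pow_mul, rot_two_mul_pow hn, ← pow_mul, h4]⟩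
  exact this.finite_zpowers

theorem rot_mem_cyclic (n : ℕ) : rot n ∈ cyclic n :=
  Subgroup.subset_closure (Set.mem_singleton _)

theorem matY_pow_mem_cyclic {n : ℕ} (hn : n ≠ 0) : matY ^ 2 ∈ cyclic (2 * n) := by
  rw [← rot_two_mul_pow hn]
  exact pow_mem (rot_mem_cyclic _) n

theorem isCyclicExtension_cyclic {n : ℕ} (hn : n ≠ 0) :
    IsCyclicExtension (cyclic (2 * n)) (binDihedral n) matY 2 := by
  refine isCyclicExtension_of_closure (S := {rot (2 * n)}) two_pos rfl ?_ (fun s hs => ?_)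
    (matY_pow_mem_cyclic hn)
  · rw [binDihedral, Set.pair_comm]
  · rw [Set.mem_singleton_iff.1 hs, matY_mul_rot]
    exact inv_mem (rot_mem_cyclic _)

theorem finite_binDihedral {n : ℕ} (hn : n ≠ 0) : Finite (binDihedral n) :=
  have := finite_cyclic hn
  (isCyclicExtension_cyclic hn).finite two_pos

theorem rot_mem_binDihedral (n : ℕ) : rot (2 * n) ∈ binDihedral n :=
  Subgroup.subset_closure (.inl rfl)

theorem matY_mem_binDihedral (n : ℕ) : matY ∈ binDihedral n :=
  Subgroup.subset_closure (.inr rfl)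

theorem isCyclicExtension_binDihedral (m : ℕ) :
    IsCyclicExtension (binDihedral m) (binDihedral (2 * m)) (rot (2 * (2 * m))) 2 := by
  have hsq := rot_two_mul_sq (2 * m)
  refine isCyclicExtension_of_closure (S := {rot (2 * m), matY}) two_pos rfl (le_antisymm ?_ ?_) (fun s hs => ?_) ?_
  · refine Subgroup.closure_mono ?_
    rintro x (rfl | rfl)
    exacts [.inl rfl, .inr (.inr rfl)]
  · rw [Subgroup.closure_le]
    rintro x (rfl | rfl | rfl)
    · exact rot_mem_binDihedral _
    · rw [← hsq]
      exact pow_mem (rot_mem_binDihedral _) 2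
    · exact matY_mem_binDihedral _
  · rcases hs with rfl | rfl
    · rw [← hsq, pow_two, ← mul_assoc, mul_inv_cancel_right, ← pow_two, hsq]
      exact rot_mem_binDihedral m
    · rw [rot_mul_matY, hsq]
      exact mul_mem (rot_mem_binDihedral m) (matY_mem_binDihedral m)
  · rw [hsq]
    exact rot_mem_binDihedral m

theorem matX_mem_binDihedral_two : matX ∈ binDihedral 2 := by
  rw [matX_eq]
  exact inv_mem (rot_mem_binDihedral 2)

theorem mem_binTetrahedral : matX ∈ binTetrahedral ∧ matY ∈ binTetrahedral ∧
    matZ ∈ binTetrahedral :=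
  ⟨Subgroup.subset_closure (.inl rfl), Subgroup.subset_closure (.inr (.inl rfl)),
    Subgroup.subset_closure (.inr (.inr rfl))⟩

theorem isCyclicExtension_binTetrahedral :
    IsCyclicExtension (binDihedral 2) binTetrahedral matZ 3 := by
  have hN : binDihedral 2 = Subgroup.closure {matX, matY} := by
    refine le_antisymm ?_ ?_ <;> rw [binDihedral, Subgroup.closure_le]
    · rintro x (rfl | rfl)
      · rw [show rot (2 * 2) = matX⁻¹ by rw [matX_eq, inv_inv]]
        exact inv_mem (Subgroup.subset_closure (.inl rfl))
      · exact Subgroup.subset_closure (.inr rfl)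
    · rintro x (rfl | rfl)
      exacts [matX_mem_binDihedral_two, matY_mem_binDihedral 2]
  refine isCyclicExtension_of_closure three_pos hN ?_ (fun s hs => ?_) ?_
  · rw [binTetrahedral]
    congr 1
    ext x
    simp only [Set.mem_insert_iff, Set.mem_singleton_iff]
    tauto
  · rcases hs with rfl | rfl
    · rw [matZ_mul_matX]
      exact mul_mem matX_mem_binDihedral_two (matY_mem_binDihedral 2)
    · rw [matZ_mul_matY]
      exact matX_mem_binDihedral_two
  · rw [matZ_pow]
    exact pow_mem matX_mem_binDihedral_two 2

theorem finite_binTetrahedral : Finite binTetrahedral :=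
  have := finite_binDihedral two_ne_zero
  isCyclicExtension_binTetrahedral.finite three_pos

theorem isCyclicExtension_binOctahedral :
    IsCyclicExtension binTetrahedral binOctahedral (rot 8)⁻¹ 2 := by
  obtain ⟨hX, hY, hZ⟩ := mem_binTetrahedral
  refine isCyclicExtension_of_closure (S := {matX, matY, matZ}) two_pos rfl (le_antisymm ?_ ?_) (fun s hs => ?_) ?_
  · refine Subgroup.closure_mono ?_
    rintro x (rfl | rfl | rfl)
    exacts [.inl rfl, .inr (.inr (.inl rfl)), .inr (.inr (.inr rfl))]
  · rw [Subgroup.closure_le]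
    rintro x (rfl | rfl | rfl | rfl)
    · exact Subgroup.subset_closure (.inl rfl)
    · rw [← rot_eight_inv_sq]
      exact pow_mem (Subgroup.subset_closure (.inl rfl)) 2
    · exact Subgroup.subset_closure (.inr (.inl rfl))
    · exact Subgroup.subset_closure (.inr (.inr rfl))
  · rcases hs with rfl | rfl | rfl
    · rw [← rot_eight_inv_sq, pow_two, ← mul_assoc, mul_inv_cancel_right, ← pow_two,
        rot_eight_inv_sq]
      exact hX
    · rw [rot_eight_inv_mul_matY]
      exact mul_mem hX hY
    · rw [rot_eight_inv_mul_matZ]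
      exact mul_mem hX (pow_mem hZ 2)
  · rw [rot_eight_inv_sq]
    exact hX

theorem IsPrimeIndexPair.finite_normal_index {G N : Subgroup SU2} (h : IsPrimeIndexPair G N) :
    Finite G ∧ (N.subgroupOf G).Normal ∧ (N.subgroupOf G).index.Prime := by
  rcases h with ⟨n, hn, rfl, rfl⟩ | ⟨n, hn, rfl, rfl⟩ | ⟨rfl, rfl⟩ | ⟨rfl, rfl⟩
  · have h1 := isCyclicExtension_binDihedral (n - 1)
    exact ⟨finite_binDihedral (by omega), h1.normal, by
      rw [h1.index_eq_of_prime Nat.prime_two (rot_notMem_binDihedral (by omega))]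
      exact Nat.prime_two⟩
  · have h1 := isCyclicExtension_cyclic (n := n) (by omega)
    exact ⟨finite_binDihedral (by omega), h1.normal, by
      rw [h1.index_eq_of_prime Nat.prime_two (matY_notMem_cyclic _)]
      exact Nat.prime_two⟩
  · have h1 := isCyclicExtension_binOctahedral
    have := finite_binTetrahedral
    exact ⟨h1.finite two_pos, h1.normal, by
      rw [h1.index_eq_of_prime Nat.prime_two rot_eight_notMem_binTetrahedral]
      exact Nat.prime_two⟩
  · have h1 := isCyclicExtension_binTetrahedral
    exact ⟨finite_binTetrahedral, h1.normal, by
      rw [h1.index_eq_of_prime Nat.prime_three (matZ_notMem_binDihedral two_ne_zero)]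
      exact Nat.prime_three⟩

theorem IsIndexFourPair.exists_eq {G N : Subgroup SU2} (h : IsIndexFourPair G N) :
    ∃ n : ℕ, n ≠ 0 ∧ G = binDihedral (2 * n) ∧ N = cyclic (2 * n) := by
  rcases h with ⟨hG, hN⟩ | ⟨n, hn, hG, hN⟩
  · exact ⟨1, one_ne_zero, hG, hN⟩
  · exact ⟨n, by omega, hG, hN⟩

theorem normal_cyclic_subgroupOf {n : ℕ} (hn : n ≠ 0) :
    ((cyclic (2 * n)).subgroupOf (binDihedral (2 * n))).Normal := by
  have hsq := rot_two_mul_sq (2 * n)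
  have hr := rot_mem_cyclic (2 * n)
  refine normal_subgroupOf_of_closure (S := {rot (2 * n)})
    (T := {rot (2 * (2 * n)), matY}) rfl rfl (fun g hg => ?_) ?_
  · refine ⟨2, two_pos, fun s hs => ?_, ?_⟩
    · rw [Set.mem_singleton_iff.1 hs]
      rcases hg with rfl | rfl
      · rwa [← hsq, pow_two, ← mul_assoc, mul_inv_cancel_right, ← pow_two, hsq]
      · rw [matY_mul_rot]
        exact inv_mem hr
    · rcases hg with rfl | rfl
      · rwa [hsq]
      · exact matY_pow_mem_cyclic hn
  · rw [cyclic, Subgroup.closure_le, Set.singleton_subset_iff, ← hsq]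
    exact pow_mem (rot_mem_binDihedral _) 2

end Pairs

/-! ### The natural module is self-dual and faithful -/

section NaturalModule

variable {G : Subgroup SU2}

theorem character_natRep (g : G) : (natRep G).character g = Matrix.trace g.1.1 :=
  Matrix.trace_toLin'_eq g.1.1

theorem star_eq_adjugate (g : SU2) : star g.1 = g.1.adjugate := by
  obtain ⟨h1, h2⟩ := Matrix.mem_specialUnitaryGroup_iff.1 g.2
  have h3 : g.1 * g.1.adjugate = 1 := by rw [Matrix.mul_adjugate, h2, one_smul]
  have h4 : star g.1 * g.1 = 1 := (Unitary.mem_iff.1 h1).1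
  calc star g.1 = star g.1 * (g.1 * g.1.adjugate) := by rw [h3, mul_one]
    _ = _ := by rw [← mul_assoc, h4, one_mul]

theorem star_apply_zero (g : SU2) : star (g.1 0 0) = g.1 1 1 := by
  have := congrFun (congrFun (star_eq_adjugate g) 0) 0
  rwa [Matrix.adjugate_fin_two] at this

theorem star_apply_one (g : SU2) : star (g.1 0 1) = -g.1 1 0 := by
  have := congrFun (congrFun (star_eq_adjugate g) 1) 0
  rwa [Matrix.adjugate_fin_two] at this

theorem character_natRep_inv (g : G) :
    (natRep G).character g⁻¹ = (natRep G).character g := by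
  rw [character_natRep, character_natRep, Matrix.trace_fin_two, Matrix.trace_fin_two]
  have h : ∀ i, (g⁻¹).1.1 i i = star (g.1.1 i i) := fun i => coe_inv_SU2 g.1 i i
  rw [h, h, star_apply_zero, ← star_apply_zero, star_star, add_comm]

/-- With first row `(a, b)` the trace is `2 Re a` and the determinant is `|a|² + |b|²`; trace `2`
and determinant `1` force `a = 1` and `b = 0`. -/
theorem eq_one_of_character_natRep {g : G}
    (h : (natRep G).character g = (natRep G).character 1) : g = 1 := by
  rw [character_natRep, character_natRep, Matrix.trace_fin_two, Matrix.trace_fin_two] at h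
  have h1 := star_apply_zero g.1
  have h2 := star_apply_one g.1
  have hdet := (Matrix.mem_specialUnitaryGroup_iff.1 g.1.2).2
  rw [Matrix.det_fin_two, ← h1, show g.1.1 1 0 = -star (g.1.1 0 1) by rw [h2, neg_neg]] at hdet
  rw [← h1] at h
  have h10 : g.1.1 1 0 = -star (g.1.1 0 1) := by rw [h2, neg_neg]
  apply Subtype.ext
  apply Subtype.ext
  generalize ha : g.1.1 0 0 = a at *
  generalize hb : g.1.1 0 1 = b at *
  have hre := congrArg Complex.re h
  have hd := congrArg Complex.re hdet
  simp at hre hd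
  have ha1 : a.re = 1 := by linarith
  have ha2 : a.im = 0 := by
    rw [ha1] at hd; nlinarith [sq_nonneg b.re, sq_nonneg b.im, sq_nonneg a.im]
  have hb1 : b.re = 0 := by
    rw [ha1] at hd; nlinarith [sq_nonneg b.re, sq_nonneg b.im, sq_nonneg a.im]
  have hb2 : b.im = 0 := by
    rw [ha1] at hd; nlinarith [sq_nonneg b.re, sq_nonneg b.im, sq_nonneg a.im]
  have ha3 : a = 1 := Complex.ext ha1 ha2
  have hb3 : b = 0 := Complex.ext hb1 hb2
  ext i j
  fin_cases i <;> fin_cases j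
  · exact ha.trans ha3
  · exact hb.trans hb3
  · refine h10.trans ?_
    rw [hb3, star_zero, neg_zero]
    rfl
  · refine h1.symm.trans ?_
    rw [ha3, star_one]
    rfl

end NaturalModule

/-! ### Irreducible modules of groups of dihedral type -/

section Dihedral

variable {G : Type*} [Group G] {a b : G} {U : Type*} [AddCommGroup U] [Module ℂ U]
  [FiniteDimensional ℂ U] {σ : Representation ℂ G U}

/-- For an eigenvector `x` of `a`, the span of `x` and `b x` is stable, since `a b x = b a⁻¹ x` and
`b² x = aᵐ x`. -/
theorem finrank_le_two (hG : Subgroup.closure {a, b} = ⊤) (hba : b * a * b⁻¹ = a⁻¹) {m : ℕ}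
    (hb : b ^ 2 = a ^ m) (hσ : σ.IsIrreducible) : finrank ℂ U ≤ 2 := by
  have := nontrivial_of_isIrreducible hσ
  obtain ⟨c, hc⟩ := Module.End.exists_eigenvalue (σ a)
  obtain ⟨x, hx, hx0⟩ := hc.exists_hasEigenvector
  rw [Module.End.mem_eigenspace_iff] at hx
  have hc0 : c ≠ 0 := by
    rintro rfl
    rw [zero_smul] at hx
    exact hx0 ((map_eq_zero_iff _ (σ.apply_bijective a).1).1 hx)
  have hxinv : σ a⁻¹ x = c⁻¹ • x := by
    rw [σ.inv_apply_eq_iff, map_smul, hx, smul_smul, inv_mul_cancel₀ hc0, one_smul]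
  have hxpow : ∀ k : ℕ, σ (a ^ k) x = c ^ k • x := fun k => by
    induction k with
    | zero => simp
    | succ k ih => rw [pow_succ, map_mul, Module.End.mul_apply, hx, map_smul, ih, smul_smul,
        ← pow_succ']
  let W := Submodule.span ℂ (Set.range ![x, σ b x])
  have hxW : x ∈ W := Submodule.subset_span ⟨0, rfl⟩
  have hbW : σ b x ∈ W := Submodule.subset_span ⟨1, rfl⟩
  have hle : ∀ g, σ g x ∈ W → σ g (σ b x) ∈ W → W.map (σ g) = W := fun g h1 h2 => by
    refine Submodule.eq_of_le_of_finrank_eq ?_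
      (LinearEquiv.finrank_map_eq (LinearEquiv.ofBijective (σ g) (σ.apply_bijective g)) W)
    rw [Submodule.map_span_le]
    rintro _ ⟨i, rfl⟩
    fin_cases i
    exacts [h1, h2]
  -- Equality rather than inclusion lets the induction pass to inverses.
  have hstab : ∀ g, W.map (σ g) = W := fun g => by
    have hg : g ∈ Subgroup.closure {a, b} := by rw [hG]; trivial
    induction hg using Subgroup.closure_induction with
    | mem g hg =>
      rcases hg with rfl | rfl
      · refine hle _ ?_ ?_
        · rw [hx]
          exact W.smul_mem _ hxW
        · have h1 : g * b = b * g⁻¹ := by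
            rw [eq_mul_inv_iff_mul_eq, mul_assoc, mul_inv_eq_iff_eq_mul.1 hba, mul_inv_cancel_left]
          rw [← Module.End.mul_apply, ← map_mul, h1, map_mul, Module.End.mul_apply, hxinv, map_smul]
          exact W.smul_mem _ hbW
      · refine hle _ hbW ?_
        rw [← Module.End.mul_apply, ← map_mul, ← pow_two, hb, hxpow]
        exact W.smul_mem _ hxW
    | one => rw [map_one, Module.End.one_eq_id, Submodule.map_id]
    | mul g h _ _ ihg ihh => rw [map_mul, Module.End.mul_eq_comp, Submodule.map_comp, ihh, ihg]
    | inv g _ ih =>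
      conv_lhs => rw [← ih]
      rw [← Submodule.map_comp, ← Module.End.mul_eq_comp, ← map_mul, inv_mul_cancel, map_one,
        Module.End.one_eq_id, Submodule.map_id]
  let S : Subrepresentation σ := ⟨W, fun g y hy => by
    have := Submodule.mem_map_of_mem (f := σ g) hy
    rwa [hstab g] at this⟩
  have hS : W = ⊤ := congrArg Subrepresentation.toSubmodule
    ((hσ.eq_bot_or_eq_top S).resolve_left fun h => hx0 (by
      have : W = ⊥ := congrArg Subrepresentation.toSubmodule h
      rw [this] at hxW
      exact hxW))
  have h2 := finrank_range_le_card (R := ℂ) ![x, σ b x]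
  change finrank ℂ W ≤ _ at h2
  rwa [hS, finrank_top, Fintype.card_fin] at h2

-- Operators on a line commute, so the relation forces `a` and `a⁻¹` to act in the same way.
omit [FiniteDimensional ℂ U] in
theorem map_sq_eq_one_of_finrank_eq_one (hba : b * a * b⁻¹ = a⁻¹) (h1 : finrank ℂ U = 1) :
    σ (a ^ 2) = 1 := by
  obtain ⟨x, hx0, hx⟩ := finrank_eq_one_iff'.1 h1
  obtain ⟨c, hc⟩ := hx (σ a x)
  obtain ⟨e, he⟩ := hx (σ b x)
  have hall : ∀ y, σ a y = c • y := fun y => by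
    obtain ⟨t, rfl⟩ := hx y
    rw [map_smul, ← hc, smul_comm]
  have hall' : ∀ y, σ b y = e • y := fun y => by
    obtain ⟨t, rfl⟩ := hx y
    rw [map_smul, ← he, smul_comm]
  rw [mul_inv_eq_iff_eq_mul] at hba
  have hab : a * b * a = b := by rw [mul_assoc, hba, mul_inv_cancel_left]
  refine LinearMap.ext fun y => ?_
  obtain ⟨z, rfl⟩ := (σ.apply_bijective b).2 y
  have h2 : σ (a * b * a) z = σ b z := by rw [hab]
  rw [map_mul, map_mul, Module.End.mul_apply, Module.End.mul_apply, hall z, map_smul, map_smul,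
    ← hall, ← Module.End.mul_apply, ← map_mul, ← pow_two] at h2
  exact h2

end Dihedral

/-! ### Dimensions for the pairs of index four -/

section IndexFour

theorem closure_binDihedral (n : ℕ) :
    Subgroup.closure {(⟨rot (2 * n), rot_mem_binDihedral n⟩ : binDihedral n),
      ⟨matY, matY_mem_binDihedral n⟩} = ⊤ := by
  refine Eq.trans ?_ (Subgroup.closure_closure_coe_preimage (k := {rot (2 * n), matY}))
  congr 1
  ext x
  exact or_congr Subtype.ext_iff Subtype.ext_iff

variable {n : ℕ} {U : Type*} [AddCommGroup U] [Module ℂ U] [FiniteDimensional ℂ U]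

/-- In dimension one the square of `rot (2 * (2 * n))` acts trivially, and that square generates
`cyclic (2 * n)`. -/
theorem finrank_of_binDihedral (hn : n ≠ 0) {σ : Representation ℂ (binDihedral (2 * n)) U}
    (hσ : σ.IsIrreducible)
    (h : ¬ IsTrivialModule (res ((cyclic (2 * n)).subgroupOf (binDihedral (2 * n))) σ)) :
    finrank ℂ U = 2 := by
  have hba : (⟨matY, matY_mem_binDihedral _⟩ : binDihedral (2 * n)) *
      ⟨rot (2 * (2 * n)), rot_mem_binDihedral _⟩ * ⟨matY, matY_mem_binDihedral _⟩⁻¹ =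
      ⟨rot (2 * (2 * n)), rot_mem_binDihedral _⟩⁻¹ := Subtype.ext (matY_mul_rot _)
  have hle := finrank_le_two (closure_binDihedral _) hba (m := 2 * n)
    (Subtype.ext (rot_two_mul_pow (m := 2 * n) (by omega)).symm) hσ
  have hpos := finrank_pos_of_isIrreducible hσ
  by_contra h2
  have h1 : finrank ℂ U = 1 := by omega
  have hsq := map_sq_eq_one_of_finrank_eq_one (σ := σ) hba h1
  apply h
  have htriv : ∀ g : (cyclic (2 * n)).subgroupOf (binDihedral (2 * n)), σ g = 1 := by
    rintro ⟨g, hg⟩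
    obtain ⟨g, hgG⟩ := g
    have hg' : g ∈ cyclic (2 * n) := hg
    rw [cyclic, ← Subgroup.zpowers_eq_closure, Subgroup.mem_zpowers_iff] at hg'
    obtain ⟨k, rfl⟩ := hg'
    have h3 : (⟨rot (2 * n) ^ k, hgG⟩ : binDihedral (2 * n)) =
        (⟨rot (2 * (2 * n)), rot_mem_binDihedral _⟩ ^ 2) ^ k := by
      apply Subtype.ext
      change _ = (rot (2 * (2 * n)) ^ 2) ^ k
      rw [rot_two_mul_sq]
    change σ ⟨rot (2 * n) ^ k, hgG⟩ = 1
    rw [h3]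
    exact MonoidHom.mem_ker.1 (Subgroup.zpow_mem (MonoidHom.ker σ) (MonoidHom.mem_ker.2 hsq) k)
  refine ⟨.mk (LinearEquiv.ofFinrankEq U ℂ (by rw [h1, finrank_self])) fun g => ?_⟩
  change _ ∘ₗ σ g = _
  rw [htriv g]
  rfl

theorem finrank_of_cyclic {G : Subgroup SU2} {φ : Representation ℂ ((cyclic n).subgroupOf G) U}
    (hφ : φ.IsIrreducible) : finrank ℂ U = 1 := by
  have : IsMulCommutative (cyclic n) := by
    rw [cyclic, ← Subgroup.zpowers_eq_closure]
    infer_instance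
  exact IsIrreducible.finrank_eq_one_of_isMulCommutative φ

end IndexFour

end McKaySlodowy

theorem mainTheorem9 (G N : Subgroup SU2)
    (hGN : IsPrimeIndexPair G N ∨ IsIndexFourPair G N)
    {I : Type v} {J : Type w} [Fintype I] [Fintype J] [DecidableEq J]
    (ρ : I → Rep.{u} ℂ G) (hρ : IsRestrictedSystem (N.subgroupOf G) ρ)
    (φ : J → Rep.{u} ℂ (N.subgroupOf G)) (hφ : IsInducedSystem (N.subgroupOf G) φ) :
    ∃ f : I ≃ J,
      (∀ i j, f i = j ↔ Corresponds (N.subgroupOf G) (ρ i) (φ j)) ∧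
      (IsPrimeIndexPair G N →
        (∃ B : Matrix J J ℕ, IsAdjacencyMatrix (N.subgroupOf G) (natRep G) φ B) ∧
        ∀ B : Matrix J J ℕ, IsAdjacencyMatrix (N.subgroupOf G) (natRep G) φ B →
          ∀ i, (IsLongRoot (cartan B) (f i) ∨ IsShortRoot (cartan B) (f i)) ∧
            (IsLongRoot (cartan B) (f i) →
              resSeries (N.subgroupOf G) (natRep G) (ρ i) =
                indSeries (N.subgroupOf G) (natRep G) (φ (f i))) ∧
            (IsShortRoot (cartan B) (f i) →
              resSeries (N.subgroupOf G) (natRep G) (ρ i) =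
                N.relIndex G • indSeries (N.subgroupOf G) (natRep G) (φ (f i)))) ∧
      (IsIndexFourPair G N →
        (∀ i j, IsTrivialModule (res (N.subgroupOf G) (ρ i).ρ) → IsTrivialModule (φ j).ρ →
          resSeries (N.subgroupOf G) (natRep G) (ρ i) =
            indSeries (N.subgroupOf G) (natRep G) (φ j)) ∧
        ∀ i, ¬ IsTrivialModule (res (N.subgroupOf G) (ρ i).ρ) →
          ¬ IsTrivialModule (φ (f i)).ρ ∧
          resSeries (N.subgroupOf G) (natRep G) (ρ i) =
            2 • indSeries (N.subgroupOf G) (natRep G) (φ (f i))) := by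
  have hfin : Finite G ∧ (N.subgroupOf G).Normal := by
    rcases hGN with h | h
    · exact ⟨h.finite_normal_index.1, h.finite_normal_index.2.1⟩
    · obtain ⟨n, hn, rfl, rfl⟩ := h.exists_eq
      exact ⟨finite_binDihedral (by omega), normal_cyclic_subgroupOf hn⟩
  obtain ⟨_, _⟩ := hfin
  obtain ⟨f, hf⟩ := hρ.exists_bijection hφ
  have hfdρ := hρ.finiteDimensional
  have hfdφ := hφ.finiteDimensional
  refine ⟨f, fun i j => by rw [corresponds_iff hρ hφ, hf], fun h => ⟨?_, fun B hB i => ?_⟩,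
    fun h => ⟨fun i j hi hj => ?_, fun i hi => ?_⟩⟩
  · exact exists_isAdjacencyMatrix hρ hφ hf h.finite_normal_index.2.2 rfl character_natRep_inv
  · obtain ⟨h1, h2, h3⟩ := long_short_of_prime_index hρ hφ hf h.finite_normal_index.2.2 rfl
      character_natRep_inv (fun _ => eq_one_of_character_natRep) hB i
    refine ⟨h1, fun hl => ?_, fun hs => ?_⟩
    · rw [hρ.resSeries_eq hφ ((hf i _).1 rfl) (h2 hl), one_smul]
    · exact hρ.resSeries_eq hφ ((hf i _).1 rfl) (h3 hs)
  · obtain ⟨e⟩ := hi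
    obtain ⟨e'⟩ := hj
    -- Both modules are trivial on `N`, so this equality is Frobenius reciprocity alone, for any
    -- such `i` and `j`.
    ext k
    rw [resSeries, indSeries, PowerSeries.coeff_mk, PowerSeries.coeff_mk]
    exact (homDim_congr_left (Representation.char_iso (e.trans e'.symm))).trans
      (homDim_ind _ (φ j).ρ (tensorPower (natRep G) k)).symm
  · obtain ⟨n, hn, rfl, rfl⟩ := h.exists_eq
    have h1 := finrank_of_binDihedral hn (hρ.irreducible i) hi
    have h2 := finrank_of_cyclic (hφ.irreducible (f i))
    refine ⟨fun ⟨e⟩ => hi ?_, hρ.resSeries_eq hφ ((hf i _).1 rfl) (by rw [h1, h2])⟩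
    -- If `φ (f i)` were trivial, it would occur in the restriction of `ρ i₀`, which is that of the
    -- trivial `G`-module. Then `i = i₀`, so `Res ρᵢ` would be trivial.
    obtain ⟨i₀, ⟨e₀⟩⟩ := hρ.exists_trivial
    have h3 : homDim (φ (f i)).ρ
        (res ((cyclic (2 * n)).subgroupOf (binDihedral (2 * n))) (ρ i₀).ρ) ≠ 0 := by
      rw [homDim_ne_zero_iff_embeds (hφ.irreducible _)]
      exact ⟨(e.trans e₀).toIntertwiningMap, (e.trans e₀).toLinearEquiv.injective⟩
    rw [hρ.eq_of_homDim_ne_zero (hφ.irreducible _) ((hf i _).1 rfl) h3]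
    exact ⟨e₀.symm⟩
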